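/- Let $s\ge 0$. For a multiindex $k\in\mathbb N^{n}$ ($\mathbb N=\{0,1,\dots\}$) write $|k|=\sum_i k_i$ and $f_k=\frac1{k!}\partial^k f$. For a weight $w:\mathbb N^{n}\to(0,\infty)$, a map $f$ from an open set $\Omega\subset\mathbb R^{n}$ to $\mathbb R^{p}$ is of class $E^{w}$ on $\Omega$ if it is smooth and every point of $\Omega$ has a neighbourhood $U\subset\Omega$ and a number $r>0$ such that $$\sup_{a\in U}\ \max_{1\le i\le p}\ \sum_{k\ne0}\frac{|f_{i,k}(a)|}{w_k}\,r^{|k|}<\infty .$$ The weight $w$ is strictly FdB (Faà di Bruno) if there is a $\lambda\ge1$ such that $$w_l\,w_{k_1}\cdots w_{k_r}\le\lambda^{r}\,w_{k_1+\dots+k_r}$$ for all $l\in\mathbb N^{n}\setminus\{0\}$, $r=|l|$, and all $k_1,\dots,k_r\in\mathbb N^{n}\setminus\{0\}$. Given weights $\tilde m:\mathbb N\to(0,\infty)$ and $m:\mathbb N^{s}\to(0,\infty)$, the product weight $\tilde m\cdot m$ on $\mathbb N^{1+s}$ is $(\tilde m\cdot m)_{(\tilde n,n)}=\tilde m_{\tilde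 n}\,m_n$. **Theorem.** Let $\tilde m\cdot m$ be strictly FdB, let $\Omega\subset\mathbb R\times\mathbb R^{s}$ be open, and let $v:\Omega\to\mathbb R^{s}$ be a time-dependent vector field of class $E^{\tilde m\cdot m}$ in (time, space). Fix an initial time $t_0\in\mathbb R$. Let $D$ be the set of all $(t,x)\in\mathbb R\times\mathbb R^{s}$ for which the initial value problem $\dot\gamma(\tau)=v(\tau,\gamma(\tau))$, $\gamma(t_0)=x$, has a solution on the closed interval between $t_0$ and $t$ (with graph in $\Omega$), and let $\varphi(t,x)=\gamma(t)$ be the value of this (unique) solution. Then $D$ is open, and the flow $\varphi:D\to\mathbb R^{s}$ is of class $E^{\tilde m\cdot m}$ on $D$. -/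

import Mathlib

open Set Topology
open scoped ENNReal ContDiff

noncomputable section

namespace Ultradiff

/-- The partial derivative `∂_i f`. -/
def partialDeriv {n : ℕ} (i : Fin n) (f : (Fin n → ℝ) → ℝ) : (Fin n → ℝ) → ℝ :=
  fun x => lineDeriv ℝ f x (Pi.single i 1)

/-- The mixed partial derivative `∂^k f = ∂_0^{k_0} ⋯ ∂_{n-1}^{k_{n-1}} f` of a multiindex `k`. -/
def mixedDeriv {n : ℕ} (k : Fin n → ℕ) (f : (Fin n → ℝ) → ℝ) : (Fin n → ℝ) → ℝ :=
  (List.finRange n).foldr (fun i g => (partialDeriv i)^[k i] g) f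

/-- The Taylor coefficient `f_k(a) = ∂^k f(a) / k!`, where `k! = k_0! ⋯ k_{n-1}!`. -/
def taylorCoeff {n : ℕ} (f : (Fin n → ℝ) → ℝ) (k : Fin n → ℕ) (a : Fin n → ℝ) : ℝ :=
  mixedDeriv k f a / ((∏ i, (k i).factorial : ℕ) : ℝ)

/-- `‖f‖^w_{a,r} = ∑_{k ≠ 0} |f_k(a)| / w_k * r^|k|` for a scalar function, as an element of
`[0, ∞]`. -/
def scalarSeminorm {n : ℕ} (w : (Fin n → ℕ) → ℝ) (f : (Fin n → ℝ) → ℝ)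
    (a : Fin n → ℝ) (r : ℝ) : ℝ≥0∞ :=
  ∑' k : {k : Fin n → ℕ // k ≠ 0},
    ENNReal.ofReal (|taylorCoeff f k.1 a| / w k.1 * r ^ (∑ i, k.1 i))

/-- `‖f‖^w_{a,r}` for a map with `p` components: the maximum over the components. -/
def weightedSeminorm {n p : ℕ} (w : (Fin n → ℕ) → ℝ) (f : (Fin n → ℝ) → Fin p → ℝ)
    (a : Fin n → ℝ) (r : ℝ) : ℝ≥0∞ :=
  ⨆ i : Fin p, scalarSeminorm w (fun x => f x i) a r

/-- The map `f` is of class `E^w` on the (open) set `Ω`: it is smooth there, and every point of `Ω`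
has a neighbourhood `U` in `Ω` and a radius `r > 0` with `sup_{x ∈ U} ‖f‖^w_{x,r} < ∞`. -/
def ClassE {n p : ℕ} (w : (Fin n → ℕ) → ℝ) (f : (Fin n → ℝ) → Fin p → ℝ)
    (Ω : Set (Fin n → ℝ)) : Prop :=
  ContDiffOn ℝ ∞ f Ω ∧
    ∀ a ∈ Ω, ∃ U ∈ 𝓝 a, U ⊆ Ω ∧ ∃ r : ℝ, 0 < r ∧ ⨆ x ∈ U, weightedSeminorm w f x r < ⊤

/-- The product weight `(m' · m)_(j, k) = m'_j * m_k` on the multiindices of time (coordinate `0`)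
and space (the remaining coordinates). -/
def productWeight {s : ℕ} (m' : ℕ → ℝ) (m : (Fin s → ℕ) → ℝ) : (Fin (s + 1) → ℕ) → ℝ :=
  fun k => m' (k 0) * m (Fin.tail k)

/-- A weight on multiindices is strictly Faà di Bruno if there is `c ≥ 1` such that
`w_l * w_{k_1} ⋯ w_{k_r} ≤ c^r * w_{k_1 + ⋯ + k_r}` for all `l ≠ 0`, `r = |l|` and all
`k_1, …, k_r ≠ 0`. -/
def StrictlyFdB {n : ℕ} (w : (Fin n → ℕ) → ℝ) : Prop :=
  ∃ c : ℝ, 1 ≤ c ∧ ∀ l : Fin n → ℕ, l ≠ 0 →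
    ∀ k : Fin (∑ i, l i) → Fin n → ℕ, (∀ j, k j ≠ 0) →
      w l * ∏ j, w (k j) ≤ c ^ (∑ i, l i) * w (∑ j, k j)

/-- The point `(t, x)` of time-space. -/
def timeSpace {s : ℕ} (t : ℝ) (x : Fin s → ℝ) : Fin (s + 1) → ℝ :=
  Fin.cons (α := fun _ => ℝ) t x

/-- `γ` solves `γ' = v(τ, γ)`, `γ(t₀) = x`, on the closed interval between `t₀` and `t`, with its
graph over that interval in the domain `Ω` of `v`. -/
def IsTrajectory {s : ℕ} (v : (Fin (s + 1) → ℝ) → Fin s → ℝ) (Ω : Set (Fin (s + 1) → ℝ))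
    (t₀ : ℝ) (x : Fin s → ℝ) (t : ℝ) (γ : ℝ → Fin s → ℝ) : Prop :=
  γ t₀ = x ∧ ∀ τ ∈ uIcc t₀ t, timeSpace τ (γ τ) ∈ Ω ∧
    HasDerivWithinAt γ (v (timeSpace τ (γ τ))) (uIcc t₀ t) τ

/-- All `(t, x)` for which the solution that starts in `x` at time `t₀` exists up to time `t`. -/
def flowDomain {s : ℕ} (v : (Fin (s + 1) → ℝ) → Fin s → ℝ) (Ω : Set (Fin (s + 1) → ℝ))
    (t₀ : ℝ) : Set (Fin (s + 1) → ℝ) :=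
  {p | ∃ γ, IsTrajectory v Ω t₀ (Fin.tail p) (p 0) γ}

open Classical in
/-- The flow of `v` with initial time `t₀`: on its domain, `(t, x)` is sent to the value at time `t`
of the solution that starts in `x` at time `t₀` (which is unique when `v` is smooth). Outside its
domain the value is irrelevant. -/
def flow {s : ℕ} (v : (Fin (s + 1) → ℝ) → Fin s → ℝ) (Ω : Set (Fin (s + 1) → ℝ))
    (t₀ : ℝ) (p : Fin (s + 1) → ℝ) : Fin s → ℝ :=
  if h : ∃ γ, IsTrajectory v Ω t₀ (Fin.tail p) (p 0) γ then h.choose (p 0) else 0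

end Ultradiff

end

/-! Smoothness and openness of the domain come from the implicit function theorem. Rescaling time to
`[0, 1]` makes the final time a parameter, and solutions become zeros of `u - y - ∫ h(u)` in the
Banach space of continuous curves. The derivative in `u` is the identity minus a Volterra operator,
which is invertible because its powers decay like `‖A‖ ^ n / n!` (`exists_smooth_solution_family`,
`exists_local_flow`).

The weighted bounds rest on one inequality, `coeffSum_comp_le`. For a finite box of nonzero
multiindices below `μ`, the weighted coefficient sum of `f ∘ g` is at most a constant times that of
`g`, provided the latter is small. The strict FdB condition enters here: it makes `w_l` times the
sum of a product of `|l|` factors at most `c ^ |l|` times the product of their sums. The smallness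
condition then leaves a geometric series over `l`. All constants are independent of `μ`, so the full
seminorm is bounded by letting the box grow.

The inequality is applied to `v ∘ (t, φ)`, which is `∂_t φ`. Pure space derivatives are controlled
by a Gronwall argument along the trajectory, since the flow is the identity at time `t₀`
(`flowSum_space_le`). Time derivatives are added one at a time through the differential equation
(`flowSum_le`). Smallness absorbs the preceding bound, so the constant does not grow with their
number. The constants do not depend on the radius `ρ`, which is chosen last (`classE_flow`). -/

noncomputable section

namespace Ultradiff

/-! ### Superposition operators on spaces of continuous curves -/

section Superposition

open unitInterval

variable {G H : Type*} [NormedAddCommGroup G] [NormedSpace ℝ G]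
  [NormedAddCommGroup H] [NormedSpace ℝ H]

/-- Pointwise application of a curve of operators to a curve of vectors. -/
def pointwiseApply (G H : Type*) [NormedAddCommGroup G] [NormedSpace ℝ G]
    [NormedAddCommGroup H] [NormedSpace ℝ H] :
    C(I, G →L[ℝ] H) →L[ℝ] C(I, G) →L[ℝ] C(I, H) :=
  LinearMap.mkContinuous₂
    (LinearMap.mk₂ ℝ (fun (A : C(I, G →L[ℝ] H)) (w : C(I, G)) =>
        (⟨fun τ => A τ (w τ), by fun_prop⟩ : C(I, H)))
      (fun _ _ _ => by ext; simp) (fun _ _ _ => by ext; simp)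
      (fun _ _ _ => by ext; simp) (fun _ _ _ => by ext; simp)) 1 (by
    intro A w
    rw [one_mul, ContinuousMap.norm_le _ (by positivity)]
    intro τ
    exact ((A τ).le_opNorm _).trans
      (mul_le_mul (A.norm_coe_le_norm τ) (w.norm_coe_le_norm τ) (norm_nonneg _) (norm_nonneg A)))

/-- The superposition operator `w ↦ h ∘ w`. -/
def superpose (h : G → H) (hh : Continuous h) (w : C(I, G)) : C(I, H) :=
  ⟨fun τ => h (w τ), hh.comp w.continuous⟩

/-- The derivative is uniformly continuous at the points of the compact set, even against points
outside it. The mean value inequality on a ball then gives the estimate. -/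
theorem exists_uniform_linear_approx {h : G → H} (hd : ContDiff ℝ 1 h) {K : Set G}
    (hK : IsCompact K) {ε : ℝ} (hε : 0 < ε) :
    ∃ δ > 0, ∀ x ∈ K, ∀ y, ‖y - x‖ < δ → ‖h y - h x - fderiv ℝ h x (y - x)‖ ≤ ε * ‖y - x‖ := by
  have hc : Continuous (fderiv ℝ h) := hd.continuous_fderiv one_ne_zero
  have := hK.uniformContinuousAt_of_continuousAt (fderiv ℝ h) (fun x _ => hc.continuousAt)
    (Metric.dist_mem_uniformity hε)
  obtain ⟨δ, hδ, hs⟩ := Metric.mem_uniformity_dist.1 this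
  refine ⟨δ, hδ, fun x hx y hy => ?_⟩
  have hdiff : Differentiable ℝ h := hd.differentiable one_ne_zero
  have := (convex_ball x δ).norm_image_sub_le_of_norm_hasFDerivWithin_le' (f := h)
    (f' := fderiv ℝ h) (φ := fderiv ℝ h x) (C := ε) (x := x) (y := y)
    (fun z _ => (hdiff z).hasFDerivAt.hasFDerivWithinAt) (fun z hz => ?_)
    (Metric.mem_ball_self hδ) (by rwa [Metric.mem_ball, dist_eq_norm])
  · exact this
  · have := hs (a := x) (b := z) (by rwa [dist_comm]) hx
    rw [← dist_eq_norm, dist_comm]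
    exact this.le

theorem hasFDerivAt_superpose {h : G → H} (hd : ContDiff ℝ 1 h) (w : C(I, G)) :
    HasFDerivAt (superpose h hd.continuous)
      (pointwiseApply G H (superpose (fderiv ℝ h) (hd.continuous_fderiv one_ne_zero) w)) w := by
  rw [hasFDerivAt_iff_isLittleO, Asymptotics.isLittleO_iff]
  intro ε hε
  obtain ⟨δ, hδ, hs⟩ := exists_uniform_linear_approx hd (isCompact_range w.continuous) hε
  filter_upwards [Metric.ball_mem_nhds w hδ] with w' hw'
  rw [ContinuousMap.norm_le _ (by positivity)]
  intro τ
  have h1 : ‖w' τ - w τ‖ ≤ ‖w' - w‖ := (w' - w).norm_coe_le_norm τ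
  rw [Metric.mem_ball, dist_eq_norm] at hw'
  refine (hs (w τ) (mem_range_self τ) (w' τ) (h1.trans_lt hw')).trans ?_
  gcongr

universe u

/-- The derivative of superposition by `h` is superposition by `fderiv ℝ h` followed by a bounded
linear map, so each induction step gains one order. The induction replaces `H` by `G →L[ℝ] H`, hence
the common universe and the quantification over spaces inside. -/
theorem contDiff_superpose_nat (n : ℕ) : ∀ {G H : Type u} [NormedAddCommGroup G] [NormedSpace ℝ G]
    [NormedAddCommGroup H] [NormedSpace ℝ H] {h : G → H} (hd : ContDiff ℝ ∞ h),
    ContDiff ℝ n (superpose h hd.continuous) := by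
  induction n with
  | zero =>
    intro G H _ _ _ _ h hd
    refine contDiff_zero.2 (continuous_iff_continuousAt.2 fun w => ?_)
    exact (hasFDerivAt_superpose (hd.of_le (by exact_mod_cast le_top)) w).continuousAt
  | succ n ih =>
    intro G H _ _ _ _ h hd
    have h1 : ContDiff ℝ 1 h := hd.of_le (by exact_mod_cast le_top)
    have hd' : ContDiff ℝ ∞ (fderiv ℝ h) := hd.fderiv_right (by simp)
    have hf : fderiv ℝ (superpose h hd.continuous)
        = fun w => pointwiseApply G H (superpose (fderiv ℝ h) hd'.continuous w) :=
      funext fun w => (hasFDerivAt_superpose h1 w).fderiv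
    push_cast
    rw [contDiff_succ_iff_fderiv]
    refine ⟨fun w => (hasFDerivAt_superpose h1 w).differentiableAt, by simp, ?_⟩
    rw [hf]
    have hl : ContDiff ℝ n (pointwiseApply G H) := ContinuousLinearMap.contDiff _
    exact hl.comp (ih hd')

theorem contDiff_superpose {G H : Type u} [NormedAddCommGroup G] [NormedSpace ℝ G]
    [NormedAddCommGroup H] [NormedSpace ℝ H] {h : G → H} (hd : ContDiff ℝ ∞ h) :
    ContDiff ℝ ∞ (superpose h hd.continuous) :=
  contDiff_infty.2 fun n => contDiff_superpose_nat n hd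

end Superposition

/-! ### Volterra operators and smooth dependence on initial values -/

section Volterra

open unitInterval

variable {G : Type*} [NormedAddCommGroup G] [NormedSpace ℝ G]

theorem continuous_projIcc_comp {G : Type*} [TopologicalSpace G] (w : C(I, G)) :
    Continuous fun r : ℝ => w (projIcc 0 1 zero_le_one r) :=
  w.continuous.comp continuous_projIcc

/-- The integration operator `w ↦ (τ ↦ ∫ r in 0..τ, w r)` on curves over the unit interval. -/
def volterra (G : Type*) [NormedAddCommGroup G] [NormedSpace ℝ G] : C(I, G) →L[ℝ] C(I, G) :=
  LinearMap.mkContinuous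
    { toFun := fun w => ⟨fun τ => ∫ r in (0 : ℝ)..τ, w (projIcc 0 1 zero_le_one r),
        (intervalIntegral.continuous_primitive
          (fun _ _ => (continuous_projIcc_comp w).intervalIntegrable _ _) 0).comp
            continuous_subtype_val⟩
      map_add' := fun w w' => by
        ext τ
        exact intervalIntegral.integral_add ((continuous_projIcc_comp w).intervalIntegrable _ _)
          ((continuous_projIcc_comp w').intervalIntegrable _ _)
      map_smul' := fun c w => by
        ext τ
        exact intervalIntegral.integral_smul c _ } 1 (by
    intro w
    rw [one_mul, ContinuousMap.norm_le _ (norm_nonneg _)]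
    intro τ
    refine (intervalIntegral.norm_integral_le_of_norm_le_const
      (fun r _ => w.norm_coe_le_norm _)).trans ?_
    rw [sub_zero, abs_of_nonneg τ.2.1]
    exact mul_le_of_le_one_right (norm_nonneg _) τ.2.2)

theorem volterra_apply (w : C(I, G)) (τ : I) :
    volterra G w τ = ∫ r in (0 : ℝ)..τ, w (projIcc 0 1 zero_le_one r) := rfl

/-- The bound must be kept pointwise in `τ`: integrating `r ^ n` at each step is what produces the
factorial. -/
theorem norm_volterra_comp_pow_apply_le (A : C(I, G →L[ℝ] G)) (n : ℕ) (w : C(I, G)) (τ : I) :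
    ‖((volterra G ∘L pointwiseApply G G A) ^ n) w τ‖
      ≤ (‖A‖ * τ) ^ n / n.factorial * ‖w‖ := by
  induction n generalizing τ with
  | zero => simpa using w.norm_coe_le_norm τ
  | succ n ih =>
    rw [pow_succ', mul_apply_eq_comp]
    set w' := ((volterra G ∘L pointwiseApply G G A) ^ n) w
    rw [ContinuousLinearMap.comp_apply, volterra_apply]
    have hint : ∫ r in (0 : ℝ)..τ, ‖A‖ * ((‖A‖ * r) ^ n / n.factorial * ‖w‖)
        = (‖A‖ * τ) ^ (n + 1) / (n + 1).factorial * ‖w‖ := by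
      have : ∀ r : ℝ, ‖A‖ * ((‖A‖ * r) ^ n / n.factorial * ‖w‖)
          = (‖A‖ ^ (n + 1) / n.factorial * ‖w‖) * r ^ n := fun r => by ring
      simp_rw [this, intervalIntegral.integral_const_mul, integral_pow, Nat.factorial_succ]
      push_cast
      have : (n.factorial : ℝ) ≠ 0 := by positivity
      field_simp
      simp
      ring
    rw [← hint]
    refine intervalIntegral.norm_integral_le_of_norm_le τ.2.1 ?_
      (Continuous.intervalIntegrable (by fun_prop) _ _)
    filter_upwards with r hr
    have hp : projIcc 0 1 zero_le_one r = (⟨r, hr.1.le, hr.2.trans τ.2.2⟩ : I) :=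
      projIcc_of_mem _ _
    rw [hp]
    refine ((A _).le_opNorm _).trans ?_
    exact mul_le_mul (A.norm_coe_le_norm _) (ih _) (norm_nonneg _) (norm_nonneg A)

theorem isUnit_one_sub_of_pow {R : Type*} [Ring R] {x : R} {n : ℕ} (h : IsUnit (1 - x ^ n)) :
    IsUnit (1 - x) := by
  have h1 : Commute (1 - x) (∑ i ∈ Finset.range n, x ^ i) :=
    (Commute.sum_right _ _ _ fun i _ => by
      exact ((Commute.one_left _).sub_left ((Commute.refl x).pow_right i)))
  rw [← mul_neg_geom_sum, h1.isUnit_mul_iff] at h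
  exact h.1

/-- The operator itself need not be a contraction, but a high power is, and `1 - x` is a commuting
factor of `1 - x ^ n`. -/
theorem isUnit_one_sub_volterra [CompleteSpace G] (A : C(I, G →L[ℝ] G)) :
    IsUnit (1 - volterra G ∘L pointwiseApply G G A) := by
  obtain ⟨n, hn⟩ := ((FloorSemiring.tendsto_pow_div_factorial_atTop ‖A‖).eventually
    (gt_mem_nhds zero_lt_one)).exists
  suffices ‖(volterra G ∘L pointwiseApply G G A) ^ n‖ ≤ ‖A‖ ^ n / n.factorial from
    isUnit_one_sub_of_pow (n := n) (isUnit_one_sub_of_norm_lt_one (R := C(I, G) →L[ℝ] C(I, G))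
      (this.trans_lt hn))
  refine ContinuousLinearMap.opNorm_le_bound _ (by positivity) fun w => ?_
  rw [ContinuousMap.norm_le _ (by positivity)]
  intro τ
  refine (norm_volterra_comp_pow_apply_le A n w τ).trans ?_
  gcongr
  · exact mul_nonneg (norm_nonneg A) τ.2.1
  · exact mul_le_of_le_one_right (norm_nonneg A) τ.2.2

/-- A solution over the unit interval of an autonomous smooth differential equation depends
smoothly on its initial value. -/
theorem exists_smooth_solution_family [CompleteSpace G] {h : G → G} (hh : ContDiff ℝ ∞ h)
    (u : C(I, G)) (hu : ∀ τ, u τ = u 0 + ∫ r in (0 : ℝ)..τ, h (u (projIcc 0 1 zero_le_one r))) :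
    ∃ Ψ : G → C(I, G), ContDiffAt ℝ ∞ Ψ (u 0) ∧ Ψ (u 0) = u ∧ ∀ᶠ y in 𝓝 (u 0), ∀ τ : I,
      Ψ y τ = y + ∫ r in (0 : ℝ)..τ, h (Ψ y (projIcc 0 1 zero_le_one r)) := by
  let c : G →L[ℝ] C(I, G) := ContinuousLinearMap.const ℝ I
  -- The zeros of `F` are the solutions of the integral equation with initial value the first
  -- argument. The implicit function theorem solves for the curve.
  let F : G × C(I, G) → C(I, G) := fun p => p.2 - c p.1 - volterra G (superpose h hh.continuous p.2)
  have hF : ContDiff ℝ ∞ F := (contDiff_snd.sub (c.contDiff.comp contDiff_fst)).sub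
    ((volterra G).contDiff.comp ((contDiff_superpose hh).comp contDiff_snd))
  have hF0 : F (u 0, u) = 0 := by
    ext τ
    simpa [F, volterra_apply, superpose, c, sub_sub, sub_eq_zero] using hu τ
  have h1 : ContDiff ℝ 1 h := hh.of_le (by exact_mod_cast le_top)
  set A := superpose (fderiv ℝ h) (h1.continuous_fderiv one_ne_zero) u
  have hd : fderiv ℝ F (u 0, u) ∘L .inr ℝ G C(I, G) = 1 - volterra G ∘L pointwiseApply G G A := by
    have e1 : HasFDerivAt F (fderiv ℝ F (u 0, u)) (u 0, u) :=
      (hF.differentiable (by simp) _).hasFDerivAt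
    have e2 : HasFDerivAt (fun w => F (u 0, w)) (fderiv ℝ F (u 0, u) ∘L .inr ℝ G C(I, G)) u :=
      e1.comp u (hasFDerivAt_prodMk_right (u 0) u)
    have e3 := ((hasFDerivAt_id (𝕜 := ℝ) u).sub_const (c (u 0))).sub
      ((volterra G).hasFDerivAt.comp u (hasFDerivAt_superpose h1 u))
    exact e2.unique e3
  have hinv : (fderiv ℝ F (u 0, u) ∘L .inr ℝ G C(I, G)).IsInvertible := by
    rw [hd]
    obtain ⟨U, hU⟩ := isUnit_one_sub_volterra A
    exact ⟨ContinuousLinearEquiv.unitsEquiv ℝ _ U, by rw [← hU]; rfl⟩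
  have hFat : ContDiffAt ℝ ∞ F (u 0, u) := hF.contDiffAt
  refine ⟨hFat.implicitFunction (by simp) hinv, hFat.contDiffAt_implicitFunction (by simp) hinv,
    hFat.implicitFunction_apply_self (by simp) hinv, ?_⟩
  filter_upwards [hFat.eventually_apply_implicitFunction (by simp) hinv] with y hy τ
  rw [hF0] at hy
  have := congrArg (fun w : C(I, G) => w τ) hy
  simpa [F, volterra_apply, superpose, c, sub_sub, sub_eq_zero] using this

end Volterra

/-! ### Cut-off, time rescaling and uniqueness of trajectories -/

/-- Multiplication by a bump function supported inside `Ω` removes the uncontrolled values outside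
`Ω`. It supplies a global Lipschitz constant for uniqueness and a global smooth field for
superposition. -/
theorem exists_contDiff_hasCompactSupport_eventuallyEq {E F : Type*} [NormedAddCommGroup E]
    [NormedSpace ℝ E] [FiniteDimensional ℝ E] [NormedAddCommGroup F] [NormedSpace ℝ F]
    {f : E → F} {Ω K : Set E} (hΩ : IsOpen Ω) (hf : ContDiffOn ℝ ∞ f Ω) (hK : IsCompact K)
    (hKΩ : K ⊆ Ω) :
    ∃ g : E → F, ContDiff ℝ ∞ g ∧ HasCompactSupport g ∧ ∀ᶠ x in 𝓝ˢ K, g x = f x := by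
  obtain ⟨L, hL, hKL, hLΩ⟩ := exists_compact_between hK hΩ hKΩ
  obtain ⟨χ, h1, h0, -⟩ := exists_contMDiffMap_one_nhds_of_subset_interior (n := (⊤ : ℕ∞))
    (modelWithCornersSelf ℝ E) hK.isClosed hKL
  refine ⟨fun x => χ x • f x, contDiff_iff_contDiffAt.2 fun x => ?_,
    HasCompactSupport.intro hL fun x hx => by simp [h0 x hx], h1.mono fun x hx => by simp [hx]⟩
  by_cases hx : x ∈ Ω
  · exact (χ.contMDiff.contDiff.contDiffAt).smul (hf.contDiffAt (hΩ.mem_nhds hx))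
  · refine (contDiffAt_const (c := (0 : F))).congr_of_eventuallyEq ?_
    filter_upwards [hL.isClosed.isOpen_compl.mem_nhds fun h => hx (hLΩ h)] with y hy
    simp [h0 y hy]

variable {s : ℕ}

@[simp]
theorem timeSpace_zero (t : ℝ) (x : Fin s → ℝ) : timeSpace t x 0 = t := rfl

@[simp]
theorem timeSpace_succ (t : ℝ) (x : Fin s → ℝ) (i : Fin s) : timeSpace t x i.succ = x i := rfl

@[simp]
theorem tail_timeSpace (t : ℝ) (x : Fin s → ℝ) : Fin.tail (timeSpace t x) = x := rfl

@[simp]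
theorem timeSpace_tail (p : Fin (s + 1) → ℝ) : timeSpace (p 0) (Fin.tail p) = p :=
  Fin.cons_self_tail p

theorem contDiffOn_timeSpace {E : Type*} [NormedAddCommGroup E] [NormedSpace ℝ E] {A : Set E}
    {f : E → ℝ} {g : E → Fin s → ℝ} (hf : ContDiffOn ℝ ∞ f A) (hg : ContDiffOn ℝ ∞ g A) :
    ContDiffOn ℝ ∞ (fun x => timeSpace (f x) (g x)) A := by
  refine contDiffOn_pi.2 fun i => ?_
  induction i using Fin.cases with
  | zero => exact hf
  | succ i => exact contDiffOn_pi.1 hg i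

theorem contDiff_tail : ContDiff ℝ ∞ (Fin.tail : (Fin (s + 1) → ℝ) → Fin s → ℝ) :=
  contDiff_pi.2 fun i => contDiff_apply ℝ ℝ i.succ

/-- The autonomous vector field on time-space whose integral curves are the graphs of the solutions
of `γ' = v(τ, γ)`. -/
def suspend (v : (Fin (s + 1) → ℝ) → Fin s → ℝ) (q : Fin (s + 1) → ℝ) : Fin (s + 1) → ℝ :=
  timeSpace 1 (v q)

/-- `q` is an integral curve of `T • suspend v` over the unit interval, inside `Ω`. -/
def IsUnitTrajectory (v : (Fin (s + 1) → ℝ) → Fin s → ℝ) (Ω : Set (Fin (s + 1) → ℝ)) (T : ℝ)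
    (q : ℝ → Fin (s + 1) → ℝ) : Prop :=
  ∀ τ ∈ Icc (0 : ℝ) 1, q τ ∈ Ω ∧ HasDerivWithinAt q (T • suspend v (q τ)) (Icc 0 1) τ

variable {v : (Fin (s + 1) → ℝ) → Fin s → ℝ} {Ω : Set (Fin (s + 1) → ℝ)} {t₀ : ℝ}

theorem mem_uIcc_of_unit {t : ℝ} {τ : ℝ} (hτ : τ ∈ Icc (0 : ℝ) 1) :
    t₀ + τ * (t - t₀) ∈ uIcc t₀ t := by
  rw [← segment_eq_uIcc, segment_eq_image']
  exact ⟨τ, hτ, by simp⟩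

/-- All solutions become curves over the same interval, whichever side of `t₀` the final time lies
on. The length `t - t₀` is now a factor of the field. -/
theorem IsTrajectory.isUnitTrajectory {x : Fin s → ℝ} {t : ℝ} {γ : ℝ → Fin s → ℝ}
    (h : IsTrajectory v Ω t₀ x t γ) :
    IsUnitTrajectory v Ω (t - t₀)
      (fun τ => timeSpace (t₀ + τ * (t - t₀)) (γ (t₀ + τ * (t - t₀)))) := by
  intro τ hτ
  obtain ⟨h1, h2⟩ := h.2 _ (mem_uIcc_of_unit hτ)
  refine ⟨h1, hasDerivWithinAt_pi.2 fun i => ?_⟩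
  have ha : HasDerivWithinAt (fun τ => t₀ + τ * (t - t₀)) (t - t₀) (Icc 0 1) τ := by
    simpa using (((hasDerivAt_id τ).mul_const (t - t₀)).const_add t₀).hasDerivWithinAt
  induction i using Fin.cases with
  | zero => simpa [suspend] using ha
  | succ i =>
    exact hasDerivWithinAt_pi.1 (h2.scomp τ ha fun _ hr => mem_uIcc_of_unit hr) i

theorem IsUnitTrajectory.continuousOn {T : ℝ} {q : ℝ → Fin (s + 1) → ℝ}
    (h : IsUnitTrajectory v Ω T q) : ContinuousOn q (Icc 0 1) :=
  fun τ hτ => (h τ hτ).2.continuousWithinAt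

theorem hasDerivWithinAt_Ici_of_Icc {E : Type*} [NormedAddCommGroup E] [NormedSpace ℝ E]
    {f : ℝ → E} {f' : E} {a b x : ℝ} (hx : x ∈ Ico a b)
    (h : HasDerivWithinAt f f' (Icc a b) x) : HasDerivWithinAt f f' (Ici x) x :=
  h.mono_of_mem_nhdsWithin (Icc_mem_nhdsGE_of_mem hx)

theorem IsUnitTrajectory.time_eq {T : ℝ} {q : ℝ → Fin (s + 1) → ℝ}
    (h : IsUnitTrajectory v Ω T q) : ∀ τ ∈ Icc (0 : ℝ) 1, q τ 0 = q 0 0 + τ * T := by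
  have hd : ∀ τ ∈ Icc (0 : ℝ) 1, HasDerivWithinAt (fun τ => q τ 0 - τ * T) 0 (Icc 0 1) τ := by
    intro τ hτ
    have : HasDerivWithinAt (fun τ => q τ 0 - τ * T) _ (Icc 0 1) τ :=
      (hasDerivWithinAt_pi.1 (h τ hτ).2 0).sub ((hasDerivAt_id τ).mul_const T).hasDerivWithinAt
    convert this using 1
    simp [suspend]
  intro τ hτ
  have := constant_of_has_deriv_right_zero (fun r hr => (hd r hr).continuousWithinAt)
    (fun r hr => hasDerivWithinAt_Ici_of_Icc hr (hd r (Ico_subset_Icc_self hr))) τ hτ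
  simp only [zero_mul, sub_zero] at this
  linarith

theorem IsUnitTrajectory.exists_isTrajectory {x : Fin s → ℝ} {T : ℝ} {q : ℝ → Fin (s + 1) → ℝ}
    (h : IsUnitTrajectory v Ω T q) (h0 : q 0 = timeSpace t₀ x) :
    ∃ γ, IsTrajectory v Ω t₀ x (t₀ + T) γ ∧ γ (t₀ + T) = Fin.tail (q 1) := by
  have htime : ∀ τ ∈ Icc (0 : ℝ) 1, q τ 0 = t₀ + τ * T := fun τ hτ => by
    rw [h.time_eq τ hτ, h0, timeSpace_zero]
  have mem0 : (0 : ℝ) ∈ Icc (0 : ℝ) 1 := ⟨le_rfl, zero_le_one⟩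
  -- For `T = 0` the rescaling cannot be inverted, but the curve is constant and the time interval
  -- is a single point.
  rcases eq_or_ne T 0 with rfl | hT
  · have hq : q 1 = q 0 := by
      refine constant_of_has_deriv_right_zero h.continuousOn (fun r hr => ?_) 1
        ⟨zero_le_one, le_rfl⟩
      simpa using hasDerivWithinAt_Ici_of_Icc hr (h r (Ico_subset_Icc_self hr)).2
    refine ⟨fun _ => x, ⟨rfl, fun τ hτ => ?_⟩, by rw [hq, h0, tail_timeSpace]⟩
    rw [add_zero, uIcc_self, mem_singleton_iff] at hτ
    rw [add_zero, uIcc_self, hτ, ← h0]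
    exact ⟨(h 0 mem0).1, HasFDerivWithinAt.of_subsingleton subsingleton_singleton⟩
  · have hmaps : MapsTo (fun τ => (τ - t₀) / T) (uIcc t₀ (t₀ + T)) (Icc 0 1) := by
      intro τ hτ
      rw [← segment_eq_uIcc, segment_eq_image'] at hτ
      obtain ⟨θ, hθ, rfl⟩ := hτ
      simpa [hT] using hθ
    refine ⟨fun τ => Fin.tail (q ((τ - t₀) / T)), ⟨by simp [h0], fun τ hτ => ?_⟩, by simp [hT]⟩
    obtain ⟨h1, h2⟩ := h _ (hmaps hτ)
    have e : timeSpace τ (Fin.tail (q ((τ - t₀) / T))) = q ((τ - t₀) / T) := by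
      conv_rhs => rw [← timeSpace_tail (q ((τ - t₀) / T)), htime _ (hmaps hτ)]
      congr 1
      field_simp
      ring
    rw [e]
    refine ⟨h1, hasDerivWithinAt_pi.2 fun i => ?_⟩
    have ha : HasDerivWithinAt (fun τ => (τ - t₀) / T) (1 / T) (uIcc t₀ (t₀ + T)) τ :=
      (((hasDerivAt_id τ).sub_const t₀).div_const T).hasDerivWithinAt
    have := hasDerivWithinAt_pi.1 (h2.scomp τ ha hmaps) i.succ
    simpa [suspend, hT, Fin.tail] using this

theorem IsUnitTrajectory.isCompact_image {T : ℝ} {q : ℝ → Fin (s + 1) → ℝ}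
    (h : IsUnitTrajectory v Ω T q) : IsCompact (q '' Icc 0 1) ∧ q '' Icc 0 1 ⊆ Ω :=
  ⟨isCompact_Icc.image_of_continuousOn h.continuousOn, by rintro _ ⟨τ, hτ, rfl⟩; exact (h τ hτ).1⟩

theorem contDiffOn_suspend (hv : ContDiffOn ℝ ∞ v Ω) : ContDiffOn ℝ ∞ (suspend v) Ω :=
  contDiffOn_timeSpace contDiffOn_const hv

/-- Cutting the field off near both compact images makes it globally Lipschitz without changing it
along either curve, so Gronwall uniqueness applies. -/
theorem IsUnitTrajectory.eqOn (hΩ : IsOpen Ω) (hv : ContDiffOn ℝ ∞ v Ω) {T : ℝ}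
    {q₁ q₂ : ℝ → Fin (s + 1) → ℝ} (h₁ : IsUnitTrajectory v Ω T q₁)
    (h₂ : IsUnitTrajectory v Ω T q₂) (h0 : q₁ 0 = q₂ 0) : EqOn q₁ q₂ (Icc 0 1) := by
  obtain ⟨V, hV, hVc, hVe⟩ := exists_contDiff_hasCompactSupport_eventuallyEq hΩ
    (contDiffOn_suspend hv) (h₁.isCompact_image.1.union h₂.isCompact_image.1)
    (union_subset h₁.isCompact_image.2 h₂.isCompact_image.2)
  obtain ⟨c, hc⟩ := hV.lipschitzWith_of_hasCompactSupport hVc (by simp)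
  refine ODE_solution_unique (v := fun _ q => T • V q)
    (fun _ => (lipschitzWith_smul T).comp hc) h₁.continuousOn (fun r hr => ?_)
    h₂.continuousOn (fun r hr => ?_) h0
  · rw [hVe.self_of_nhdsSet _ (Or.inl ⟨r, Ico_subset_Icc_self hr, rfl⟩)]
    exact hasDerivWithinAt_Ici_of_Icc hr (h₁ r (Ico_subset_Icc_self hr)).2
  · rw [hVe.self_of_nhdsSet _ (Or.inr ⟨r, Ico_subset_Icc_self hr, rfl⟩)]
    exact hasDerivWithinAt_Ici_of_Icc hr (h₂ r (Ico_subset_Icc_self hr)).2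

theorem IsTrajectory.eq_endpoint (hΩ : IsOpen Ω) (hv : ContDiffOn ℝ ∞ v Ω) {x : Fin s → ℝ} {t : ℝ}
    {γ₁ γ₂ : ℝ → Fin s → ℝ} (h₁ : IsTrajectory v Ω t₀ x t γ₁) (h₂ : IsTrajectory v Ω t₀ x t γ₂) :
    γ₁ t = γ₂ t := by
  have := h₁.isUnitTrajectory.eqOn hΩ hv h₂.isUnitTrajectory (by simp [h₁.1, h₂.1])
    (x := 1) ⟨zero_le_one, le_rfl⟩
  simpa using congrArg Fin.tail this

/-- By uniqueness, the choice made in `flow` is harmless. -/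
theorem flow_eq (hΩ : IsOpen Ω) (hv : ContDiffOn ℝ ∞ v Ω) {p : Fin (s + 1) → ℝ}
    {γ : ℝ → Fin s → ℝ} (h : IsTrajectory v Ω t₀ (Fin.tail p) (p 0) γ) :
    flow v Ω t₀ p = γ (p 0) := by
  have hex : ∃ γ, IsTrajectory v Ω t₀ (Fin.tail p) (p 0) γ := ⟨γ, h⟩
  rw [flow, dif_pos hex]
  exact hex.choose_spec.eq_endpoint hΩ hv h

theorem IsTrajectory.restrict {x : Fin s → ℝ} {t τ : ℝ} {γ : ℝ → Fin s → ℝ}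
    (h : IsTrajectory v Ω t₀ x t γ) (hτ : τ ∈ uIcc t₀ t) : IsTrajectory v Ω t₀ x τ γ := by
  have hsub : uIcc t₀ τ ⊆ uIcc t₀ t := uIcc_subset_uIcc_left hτ
  exact ⟨h.1, fun r hr => ⟨(h.2 r (hsub hr)).1, (h.2 r (hsub hr)).2.mono hsub⟩⟩

theorem IsTrajectory.mem_flowDomain {x : Fin s → ℝ} {t τ : ℝ} {γ : ℝ → Fin s → ℝ}
    (h : IsTrajectory v Ω t₀ x t γ) (hτ : τ ∈ uIcc t₀ t) :
    timeSpace τ x ∈ flowDomain v Ω t₀ :=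
  ⟨γ, h.restrict hτ⟩

theorem IsTrajectory.flow_eq (hΩ : IsOpen Ω) (hv : ContDiffOn ℝ ∞ v Ω) {x : Fin s → ℝ} {t τ : ℝ}
    {γ : ℝ → Fin s → ℝ} (h : IsTrajectory v Ω t₀ x t γ) (hτ : τ ∈ uIcc t₀ t) :
    flow v Ω t₀ (timeSpace τ x) = γ τ :=
  Ultradiff.flow_eq hΩ hv (p := timeSpace τ x) (h.restrict hτ)

/-! ### Openness of the flow domain and smoothness of the flow -/

section SmoothFlow

open unitInterval

variable {s : ℕ} {v : (Fin (s + 1) → ℝ) → Fin s → ℝ} {Ω : Set (Fin (s + 1) → ℝ)} {t₀ : ℝ}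

theorem hasDerivWithinAt_of_integral_eq {G : Type*} [NormedAddCommGroup G] [NormedSpace ℝ G]
    [CompleteSpace G] {h : G → G} (hh : Continuous h) {u : C(I, G)} {y : G}
    (hu : ∀ τ : I, u τ = y + ∫ r in (0 : ℝ)..τ, h (u (projIcc 0 1 zero_le_one r))) {τ : ℝ}
    (hτ : τ ∈ Icc (0 : ℝ) 1) :
    HasDerivWithinAt (fun r => u (projIcc 0 1 zero_le_one r))
      (h (u (projIcc 0 1 zero_le_one τ))) (Icc 0 1) τ := by
  have hc : Continuous fun r : ℝ => h (u (projIcc 0 1 zero_le_one r)) :=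
    hh.comp (continuous_projIcc_comp u)
  have := ((hc.integral_hasStrictDerivAt 0 τ).hasDerivAt.const_add y).hasDerivWithinAt
    (s := Icc 0 1)
  refine this.congr_of_mem (fun r hr => ?_) hτ
  rw [hu, projIcc_of_mem _ hr]

/-- Near `p₁` the flow is the composite of the smooth initial data `Y`, the smooth solution family
`Ψ`, evaluation at `1` and a projection. -/
theorem exists_local_flow (hΩ : IsOpen Ω) (hv : ContDiffOn ℝ ∞ v Ω) {p₁ : Fin (s + 1) → ℝ}
    (hp₁ : p₁ ∈ flowDomain v Ω t₀) :
    (∀ᶠ p in 𝓝 p₁, p ∈ flowDomain v Ω t₀) ∧ ContDiffAt ℝ ∞ (flow v Ω t₀) p₁ := by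
  obtain ⟨γ, hγ⟩ := hp₁
  have hq := hγ.isUnitTrajectory
  set q := fun τ => timeSpace (t₀ + τ * (p₁ 0 - t₀)) (γ (t₀ + τ * (p₁ 0 - t₀))) with hqdef
  have hq0 : q 0 = timeSpace t₀ (Fin.tail p₁) := by simp [hqdef, hγ.1]
  obtain ⟨V, hV, -, hVe⟩ := exists_contDiff_hasCompactSupport_eventuallyEq hΩ
    (contDiffOn_suspend hv) hq.isCompact_image.1 hq.isCompact_image.2
  have hVΩ : ∀ᶠ x in 𝓝ˢ (q '' Icc 0 1), V x = suspend v x ∧ x ∈ Ω :=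
    hVe.and (hΩ.mem_nhdsSet.2 hq.isCompact_image.2)
  obtain ⟨W, hW, hKW, hWV⟩ := eventually_nhdsSet_iff_exists.1 hVΩ
  -- The length of the time interval is adjoined as a constant state variable, so that smooth
  -- dependence on initial values also covers dependence on the final time.
  let h : ℝ × (Fin (s + 1) → ℝ) → ℝ × (Fin (s + 1) → ℝ) := fun y => (0, y.1 • V y.2)
  have hh : ContDiff ℝ ∞ h :=
    contDiff_const.prodMk (contDiff_fst.smul (hV.comp contDiff_snd))
  let Y : (Fin (s + 1) → ℝ) → ℝ × (Fin (s + 1) → ℝ) :=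
    fun p => (p 0 - t₀, timeSpace t₀ (Fin.tail p))
  have hY : ContDiff ℝ ∞ Y := ((contDiff_apply ℝ ℝ 0).sub contDiff_const).prodMk
    (contDiffOn_univ.1 (contDiffOn_timeSpace contDiffOn_const contDiff_tail.contDiffOn))
  let u : C(I, ℝ × (Fin (s + 1) → ℝ)) :=
    ⟨fun τ => (p₁ 0 - t₀, q τ), continuous_const.prodMk hq.continuousOn.domRestrict⟩
  have hu0 : u 0 = Y p₁ := Prod.ext rfl hq0
  have hproj : ∀ r (hr : r ∈ Icc (0 : ℝ) 1),
      u (projIcc 0 1 zero_le_one r) = (p₁ 0 - t₀, q r) := fun r hr => by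
    rw [projIcc_of_mem _ hr]; rfl
  have hu : ∀ τ, u τ = u 0 + ∫ r in (0 : ℝ)..τ, h (u (projIcc 0 1 zero_le_one r)) := by
    intro τ
    have hsub : Icc (0 : ℝ) τ ⊆ Icc 0 1 := Icc_subset_Icc_right τ.2.2
    have hd : ∀ r ∈ Icc (0 : ℝ) 1, HasDerivWithinAt (fun r => (p₁ 0 - t₀, q r))
        (h (u (projIcc 0 1 zero_le_one r))) (Icc 0 1) r := by
      intro r hr
      rw [hproj r hr]
      have : h (p₁ 0 - t₀, q r) = (0, (p₁ 0 - t₀) • suspend v (q r)) := by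
        simp only [h]
        rw [hVe.self_of_nhdsSet _ ⟨r, hr, rfl⟩]
      rw [this]
      exact (hasDerivWithinAt_const _ _ _).prodMk (hq r hr).2
    rw [intervalIntegral.integral_eq_sub_of_hasDeriv_right_of_le τ.2.1
      (f := fun r => (p₁ 0 - t₀, q r))
      (fun r hr => (hd r (hsub hr)).continuousWithinAt.mono hsub)
      (fun r hr => (hasDerivWithinAt_Ici_of_Icc ⟨hr.1.le, hr.2.trans_le τ.2.2⟩
        (hd r (hsub (Ioo_subset_Icc_self hr)))).mono Ioi_subset_Ici_self)
      ((hh.continuous.comp (continuous_projIcc_comp u)).intervalIntegrable _ _)]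
    exact (add_sub_cancel _ _).symm
  obtain ⟨Ψ, hΨ, hΨu, hΨe⟩ := exists_smooth_solution_family hh u hu
  rw [hu0] at hΨ hΨu hΨe
  -- Mapping a compact interval into an open set is an open condition on curves. Nearby solutions
  -- thus stay where the cut-off field is the original one.
  have hnear : ∀ᶠ y in 𝓝 (Y p₁), MapsTo (Ψ y) univ (Prod.snd ⁻¹' W) := by
    have hc := hΨ.continuousAt
    rw [ContinuousAt, hΨu] at hc
    refine hc.eventually ((ContinuousMap.isOpen_setOfPred_mapsTo isCompact_univ
      (hW.preimage continuous_snd)).mem_nhds ?_)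
    exact fun τ _ => hKW ⟨τ, τ.2, rfl⟩
  have key : ∀ᶠ p in 𝓝 p₁, p ∈ flowDomain v Ω t₀ ∧
      flow v Ω t₀ p = Fin.tail (Ψ (Y p) 1).2 := by
    filter_upwards [hY.continuous.continuousAt.eventually hnear,
      hY.continuous.continuousAt.eventually hΨe] with p hp hpe
    have hd := fun τ hτ => hasDerivWithinAt_of_integral_eq hh.continuous hpe (τ := τ) hτ
    have hd1 : ∀ τ ∈ Icc (0 : ℝ) 1, HasDerivWithinAt
        (fun r => (Ψ (Y p) (projIcc 0 1 zero_le_one r)).1) 0 (Icc 0 1) τ :=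
      fun τ hτ => by
        simpa [h] using HasFDerivWithinAt.hasDerivWithinAt (hd τ hτ).hasFDerivWithinAt.fst
    have hT : ∀ τ ∈ Icc (0 : ℝ) 1, (Ψ (Y p) (projIcc 0 1 zero_le_one τ)).1 = p 0 - t₀ := by
      intro τ hτ
      have := constant_of_has_deriv_right_zero
        (f := fun τ => (Ψ (Y p) (projIcc 0 1 zero_le_one τ)).1)
        (fun r hr => (hd1 r hr).continuousWithinAt)
        (fun r hr => hasDerivWithinAt_Ici_of_Icc hr (hd1 r (Ico_subset_Icc_self hr))) τ hτ
      rw [this, projIcc_left]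
      have := hpe 0
      rw [Set.Icc.coe_zero, intervalIntegral.integral_same, add_zero] at this
      exact congrArg Prod.fst this
    have hunit : IsUnitTrajectory v Ω (p 0 - t₀)
        (fun τ => (Ψ (Y p) (projIcc 0 1 zero_le_one τ)).2) := by
      intro τ hτ
      obtain ⟨e, hm⟩ := hWV _ (hp (mem_univ (projIcc 0 1 zero_le_one τ)))
      refine ⟨hm, ?_⟩
      rw [← e, ← hT τ hτ]
      exact (hd τ hτ).snd
    have h0 : (Ψ (Y p) (projIcc 0 1 zero_le_one 0)).2 = timeSpace t₀ (Fin.tail p) := by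
      rw [projIcc_left]
      have := hpe 0
      rw [Set.Icc.coe_zero, intervalIntegral.integral_same, add_zero] at this
      exact congrArg Prod.snd this
    obtain ⟨γ', hγ', hend⟩ := hunit.exists_isTrajectory h0
    rw [add_sub_cancel] at hγ' hend
    refine ⟨⟨γ', hγ'⟩, ?_⟩
    rw [flow_eq hΩ hv hγ', hend, projIcc_right]
    rfl
  refine ⟨key.mono fun p hp => hp.1, ContDiffAt.congr_of_eventuallyEq ?_
    (key.mono fun p hp => hp.2)⟩
  have hev : ContDiff ℝ ∞ fun w : C(I, ℝ × (Fin (s + 1) → ℝ)) => w 1 :=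
    ContinuousLinearMap.contDiff
      (ContinuousMap.evalCLM ℝ (1 : I) : C(I, ℝ × (Fin (s + 1) → ℝ)) →L[ℝ] _)
  exact contDiff_tail.contDiffAt.comp p₁ (contDiff_snd.contDiffAt.comp p₁
    (hev.contDiffAt.comp p₁ (hΨ.comp p₁ hY.contDiffAt)))

theorem isOpen_flowDomain (hΩ : IsOpen Ω) (hv : ContDiffOn ℝ ∞ v Ω) :
    IsOpen (flowDomain v Ω t₀) :=
  isOpen_iff_mem_nhds.2 fun _ hp => (exists_local_flow hΩ hv hp).1

theorem contDiffOn_flow (hΩ : IsOpen Ω) (hv : ContDiffOn ℝ ∞ v Ω) :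
    ContDiffOn ℝ ∞ (flow v Ω t₀) (flowDomain v Ω t₀) :=
  fun _ hp => (exists_local_flow hΩ hv hp).2.contDiffWithinAt

/-- The map `(t, x) ↦ (t, φ(t, x))` of the flow `φ`. -/
def graphFlow (v : (Fin (s + 1) → ℝ) → Fin s → ℝ) (Ω : Set (Fin (s + 1) → ℝ)) (t₀ : ℝ)
    (p : Fin (s + 1) → ℝ) : Fin (s + 1) → ℝ :=
  timeSpace (p 0) (flow v Ω t₀ p)

theorem contDiffOn_graphFlow (hΩ : IsOpen Ω) (hv : ContDiffOn ℝ ∞ v Ω) :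
    ContDiffOn ℝ ∞ (graphFlow v Ω t₀) (flowDomain v Ω t₀) :=
  contDiffOn_timeSpace (contDiff_apply ℝ ℝ 0).contDiffOn (contDiffOn_flow hΩ hv)

theorem mapsTo_graphFlow (hΩ : IsOpen Ω) (hv : ContDiffOn ℝ ∞ v Ω) :
    MapsTo (graphFlow v Ω t₀) (flowDomain v Ω t₀) Ω := by
  rintro p ⟨γ, hγ⟩
  rw [graphFlow, flow_eq hΩ hv hγ]
  exact (hγ.2 _ right_mem_uIcc).1

theorem flow_initial {x : Fin s → ℝ} (hΩ : IsOpen Ω) (hv : ContDiffOn ℝ ∞ v Ω)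
    (h : timeSpace t₀ x ∈ flowDomain v Ω t₀) : flow v Ω t₀ (timeSpace t₀ x) = x := by
  obtain ⟨γ, hγ⟩ := h
  rw [flow_eq hΩ hv hγ]
  exact hγ.1

theorem timeSpace_mem_flowDomain {p : Fin (s + 1) → ℝ} (hp : p ∈ flowDomain v Ω t₀) {τ : ℝ}
    (hτ : τ ∈ uIcc t₀ (p 0)) : timeSpace τ (Fin.tail p) ∈ flowDomain v Ω t₀ := by
  obtain ⟨γ, hγ⟩ := hp
  exact hγ.mem_flowDomain hτ

/-- The flow satisfies its differential equation. -/
theorem fderiv_flow_time (hΩ : IsOpen Ω) (hv : ContDiffOn ℝ ∞ v Ω) {p : Fin (s + 1) → ℝ}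
    (hp : p ∈ flowDomain v Ω t₀) :
    fderiv ℝ (flow v Ω t₀) p (Pi.single 0 1) = v (graphFlow v Ω t₀ p) := by
  have hD := isOpen_flowDomain (t₀ := t₀) hΩ hv
  have hline : ∀ r : ℝ, p + r • Pi.single 0 1 = timeSpace (p 0 + r) (Fin.tail p) := by
    intro r
    ext i
    induction i using Fin.cases with
    | zero => simp
    | succ i => simp [Fin.tail]
  have hcont : Continuous fun r : ℝ => p + r • (Pi.single 0 1 : Fin (s + 1) → ℝ) := by fun_prop
  have hev : ∀ᶠ r : ℝ in 𝓝 0, p + r • (Pi.single 0 1 : Fin (s + 1) → ℝ) ∈ flowDomain v Ω t₀ :=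
    hcont.continuousAt.eventually (by simpa using hD.mem_nhds hp)
  obtain ⟨ε, hε, hball⟩ := Metric.eventually_nhds_iff_ball.1 hev
  -- The final time is moved past `p 0`, away from `t₀`, so the interval is nondegenerate even if `p
  -- 0 = t₀`. A derivative within it then determines the two-sided one.
  obtain ⟨t, ht, htd⟩ : ∃ t, p 0 ∈ uIcc t₀ t ∧ |t - p 0| = ε / 2 := by
    rcases le_total t₀ (p 0) with h | h
    · exact ⟨p 0 + ε / 2, by rw [mem_uIcc]; left; constructor <;> linarith,
        by rw [add_sub_cancel_left, abs_of_pos (by positivity)]⟩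
    · exact ⟨p 0 - ε / 2, by rw [mem_uIcc]; right; constructor <;> linarith,
        by rw [sub_sub_cancel_left, abs_neg, abs_of_pos (by positivity)]⟩
  have htp : t ≠ p 0 := by
    rintro rfl
    simp at htd
    linarith
  obtain ⟨γ, hγ⟩ : timeSpace t (Fin.tail p) ∈ flowDomain v Ω t₀ := by
    have := hball (t - p 0) (by rw [mem_ball_zero_iff, Real.norm_eq_abs, htd]; linarith)
    rwa [hline, add_sub_cancel] at this
  simp only [timeSpace_zero, tail_timeSpace] at hγ
  have h1 : HasDerivAt (fun τ => flow v Ω t₀ (timeSpace τ (Fin.tail p)))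
      (fderiv ℝ (flow v Ω t₀) p (Pi.single 0 1)) (p 0) := by
    have hdiff : HasFDerivAt (flow v Ω t₀) (fderiv ℝ (flow v Ω t₀) p)
        (timeSpace (p 0) (Fin.tail p)) := by
      rw [timeSpace_tail]
      exact ((contDiffOn_flow hΩ hv).contDiffAt (hD.mem_nhds hp)).differentiableAt
        (by simp) |>.hasFDerivAt
    have hts : HasDerivAt (fun τ => timeSpace τ (Fin.tail p)) (Pi.single 0 1) (p 0) := by
      refine hasDerivAt_pi.2 fun i => ?_
      induction i using Fin.cases with
      | zero => simpa using hasDerivAt_id' (p 0)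
      | succ i => simpa using hasDerivAt_const (p 0) (Fin.tail p i)
    exact hdiff.comp_hasDerivAt (p 0) hts
  have h2 : HasDerivWithinAt (fun τ => flow v Ω t₀ (timeSpace τ (Fin.tail p)))
      (v (graphFlow v Ω t₀ p)) (uIcc t₀ t) (p 0) := by
    have e : graphFlow v Ω t₀ p = timeSpace (p 0) (γ (p 0)) := by
      rw [graphFlow, ← hγ.flow_eq hΩ hv ht, timeSpace_tail]
    rw [e]
    exact (hγ.2 _ ht).2.congr (fun τ hτ => hγ.flow_eq hΩ hv hτ) (hγ.flow_eq hΩ hv ht)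
  have hne : t₀ ≠ t := by
    rintro rfl
    rw [uIcc_self, mem_singleton_iff] at ht
    exact htp ht.symm
  exact (uniqueDiffOn_Icc (inf_lt_sup.2 hne) _ ht).eq_deriv _ h1.hasDerivWithinAt h2

end SmoothFlow

/-! ### Iterated partial derivatives and Taylor coefficients -/

section PartialDeriv

variable {n : ℕ} {Ω A : Set (Fin n → ℝ)} {f h : (Fin n → ℝ) → ℝ}

/-- Every point of `A` can be moved a little along the `i`-th coordinate without leaving `A`. -/
def OpenAlong (A : Set (Fin n → ℝ)) (i : Fin n) : Prop :=
  ∀ a ∈ A, ∀ᶠ r : ℝ in 𝓝 0, a + r • Pi.single i 1 ∈ A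

theorem _root_.IsOpen.openAlong (hΩ : IsOpen Ω) (i : Fin n) : OpenAlong Ω i := by
  intro a ha
  have hc : Continuous fun r : ℝ => a + r • (Pi.single i 1 : Fin n → ℝ) := by fun_prop
  exact hc.continuousAt.eventually (by simpa using hΩ.mem_nhds ha)

/-- Room in the direction of differentiation suffices. The set need not be open, which permits
differentiating in space on the slice at time `t₀`. -/
theorem _root_.Set.EqOn.partialDeriv {i : Fin n} (hfh : EqOn f h A) (hA : OpenAlong A i) :
    EqOn (partialDeriv i f) (partialDeriv i h) A := by
  intro a ha
  refine Filter.EventuallyEq.deriv_eq ?_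
  filter_upwards [hA a ha] with r hr using hfh hr

theorem _root_.Set.EqOn.iterate_partialDeriv {i : Fin n} (hfh : EqOn f h A) {m : ℕ}
    (hA : m ≠ 0 → OpenAlong A i) : EqOn ((partialDeriv i)^[m] f) ((partialDeriv i)^[m] h) A := by
  induction m with
  | zero => exact hfh
  | succ m ih =>
    rw [Function.iterate_succ_apply', Function.iterate_succ_apply']
    exact (ih fun _ => hA (by simp)).partialDeriv (hA (by simp))

theorem partialDeriv_eq_fderiv {a : Fin n → ℝ} (hf : DifferentiableAt ℝ f a) (i : Fin n) :
    partialDeriv i f a = fderiv ℝ f a (Pi.single i 1) :=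
  hf.lineDeriv_eq_fderiv

theorem _root_.ContDiffOn.differentiableAt_of_isOpen {E F : Type*} [NormedAddCommGroup E]
    [NormedSpace ℝ E] [NormedAddCommGroup F] [NormedSpace ℝ F] {f : E → F} {Ω : Set E}
    (hf : ContDiffOn ℝ ∞ f Ω) (hΩ : IsOpen Ω) {a : E} (ha : a ∈ Ω) : DifferentiableAt ℝ f a :=
  (hf.contDiffAt (hΩ.mem_nhds ha)).differentiableAt (by simp)

theorem contDiffOn_partialDeriv (hΩ : IsOpen Ω) (hf : ContDiffOn ℝ ∞ f Ω) (i : Fin n) :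
    ContDiffOn ℝ ∞ (partialDeriv i f) Ω :=
  ((hf.fderiv_of_isOpen hΩ (by simp)).clm_apply contDiffOn_const).congr fun _ ha =>
    partialDeriv_eq_fderiv (hf.differentiableAt_of_isOpen hΩ ha) i

theorem contDiffOn_iterate_partialDeriv (hΩ : IsOpen Ω) (hf : ContDiffOn ℝ ∞ f Ω) (i : Fin n)
    (m : ℕ) : ContDiffOn ℝ ∞ ((partialDeriv i)^[m] f) Ω := by
  induction m with
  | zero => exact hf
  | succ m ih =>
    rw [Function.iterate_succ_apply']
    exact contDiffOn_partialDeriv hΩ ih i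

theorem partialDeriv_comm (hΩ : IsOpen Ω) (hf : ContDiffOn ℝ ∞ f Ω) (i j : Fin n) :
    EqOn (partialDeriv i (partialDeriv j f)) (partialDeriv j (partialDeriv i f)) Ω := by
  intro a ha
  have key : ∀ i j : Fin n, partialDeriv i (partialDeriv j f) a
      = fderiv ℝ (fderiv ℝ f) a (Pi.single i 1) (Pi.single j 1) := by
    intro i j
    have e : EqOn (partialDeriv j f) (fun x => fderiv ℝ f x (Pi.single j 1)) Ω := fun x hx =>
      partialDeriv_eq_fderiv (hf.differentiableAt_of_isOpen hΩ hx) j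
    rw [e.partialDeriv (hΩ.openAlong i) ha]
    have hd : DifferentiableAt ℝ (fderiv ℝ f) a :=
      (hf.fderiv_of_isOpen hΩ (m := ∞) (by simp)).differentiableAt_of_isOpen hΩ ha
    rw [partialDeriv_eq_fderiv (hd.clm_apply (differentiableAt_const _)),
      fderiv_clm_apply hd (differentiableAt_const _)]
    simp
  rw [key, key]
  exact ((hf.contDiffAt (hΩ.mem_nhds ha)).isSymmSndFDerivAt
    (by rw [minSmoothness_of_isRCLikeNormedField]; exact WithTop.coe_le_coe.2 (le_top : (2 : ℕ∞) ≤ ⊤))) _ _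

theorem partialDeriv_iterate_comm (hΩ : IsOpen Ω) (hf : ContDiffOn ℝ ∞ f Ω) (i j : Fin n) (m : ℕ) :
    EqOn (partialDeriv j ((partialDeriv i)^[m] f)) ((partialDeriv i)^[m] (partialDeriv j f)) Ω := by
  induction m with
  | zero => exact fun _ _ => rfl
  | succ m ih =>
    rw [Function.iterate_succ_apply', Function.iterate_succ_apply']
    exact (partialDeriv_comm hΩ (contDiffOn_iterate_partialDeriv hΩ hf i m) j i).trans
      (ih.partialDeriv (hΩ.openAlong i))

/-- The mixed partial derivative along the coordinates of a list. -/
def listDeriv (l : List (Fin n)) (k : Fin n → ℕ) (f : (Fin n → ℝ) → ℝ) : (Fin n → ℝ) → ℝ :=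
  l.foldr (fun i g => (partialDeriv i)^[k i] g) f

theorem listDeriv_cons (i : Fin n) (l : List (Fin n)) (k : Fin n → ℕ) :
    listDeriv (i :: l) k f = (partialDeriv i)^[k i] (listDeriv l k f) := rfl

theorem contDiffOn_listDeriv (hΩ : IsOpen Ω) (hf : ContDiffOn ℝ ∞ f Ω) (l : List (Fin n))
    (k : Fin n → ℕ) : ContDiffOn ℝ ∞ (listDeriv l k f) Ω := by
  induction l with
  | nil => exact hf
  | cons i l ih => exact contDiffOn_iterate_partialDeriv hΩ ih i _

theorem _root_.Set.EqOn.listDeriv (hfh : EqOn f h A) (l : List (Fin n)) {k : Fin n → ℕ}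
    (hA : ∀ i, k i ≠ 0 → OpenAlong A i) : EqOn (listDeriv l k f) (listDeriv l k h) A := by
  induction l with
  | nil => exact hfh
  | cons i l ih => exact ih.iterate_partialDeriv (hA i)

theorem partialDeriv_listDeriv (hΩ : IsOpen Ω) (hf : ContDiffOn ℝ ∞ f Ω) (l : List (Fin n))
    (k : Fin n → ℕ) (j : Fin n) :
    EqOn (partialDeriv j (listDeriv l k f)) (listDeriv l k (partialDeriv j f)) Ω := by
  induction l with
  | nil => exact fun _ _ => rfl
  | cons i l ih =>
    exact (partialDeriv_iterate_comm hΩ (contDiffOn_listDeriv hΩ hf l k) i j (k i)).trans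
      (ih.iterate_partialDeriv fun _ => hΩ.openAlong i)

theorem listDeriv_congr_index {l : List (Fin n)} {k k' : Fin n → ℕ} (hk : ∀ i ∈ l, k i = k' i) :
    listDeriv l k f = listDeriv l k' f := by
  induction l with
  | nil => rfl
  | cons i l ih =>
    rw [listDeriv_cons, listDeriv_cons, hk i (by simp), ih fun j hj => hk j (by simp [hj])]

/-- Symmetry of mixed derivatives moves the extra derivative innermost. Absence of duplicates
ensures that it is counted once. -/
theorem listDeriv_add_single (hΩ : IsOpen Ω) (hf : ContDiffOn ℝ ∞ f Ω) {l : List (Fin n)}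
    (hl : l.Nodup) (k : Fin n → ℕ) {j : Fin n} (hj : j ∈ l) :
    EqOn (listDeriv l (k + Pi.single j 1) f) (listDeriv l k (partialDeriv j f)) Ω := by
  induction l with
  | nil => simp at hj
  | cons i l ih =>
    rw [List.nodup_cons] at hl
    rw [listDeriv_cons, listDeriv_cons]
    by_cases hij : i = j
    · subst hij
      have e : listDeriv l (k + Pi.single i 1) f = listDeriv l k f :=
        listDeriv_congr_index fun m hm => by
          have : m ≠ i := fun h => hl.1 (h ▸ hm)
          simp [this]
      rw [e]
      simp only [Pi.add_apply, Pi.single_eq_same]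
      rw [Function.iterate_succ_apply]
      exact (partialDeriv_listDeriv hΩ hf l k i).iterate_partialDeriv fun _ => hΩ.openAlong i
    · have hj' : j ∈ l := by
        rcases List.mem_cons.1 hj with h | h
        · exact absurd h.symm hij
        · exact h
      have e : (k + Pi.single j 1 : Fin n → ℕ) i = k i := by simp [hij]
      rw [e]
      exact (ih hl.2 hj').iterate_partialDeriv fun _ => hΩ.openAlong i

theorem mixedDeriv_add_single (hΩ : IsOpen Ω) (hf : ContDiffOn ℝ ∞ f Ω) (k : Fin n → ℕ)
    (j : Fin n) :
    EqOn (mixedDeriv (k + Pi.single j 1) f) (mixedDeriv k (partialDeriv j f)) Ω :=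
  listDeriv_add_single hΩ hf (List.nodup_finRange n) k (List.mem_finRange j)

theorem mixedDeriv_zero : mixedDeriv 0 f = f := by
  have : ∀ l : List (Fin n), listDeriv l 0 f = f := fun l => by
    induction l with
    | nil => rfl
    | cons i l ih => rw [listDeriv_cons, ih]; rfl
  exact this _

theorem taylorCoeff_zero (a : Fin n → ℝ) : taylorCoeff f 0 a = f a := by
  simp [taylorCoeff, mixedDeriv_zero]

theorem _root_.Set.EqOn.taylorCoeff (hfh : EqOn f h A) {k : Fin n → ℕ}
    (hA : ∀ i, k i ≠ 0 → OpenAlong A i) : EqOn (taylorCoeff f k) (taylorCoeff h k) A := by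
  intro a ha
  rw [Ultradiff.taylorCoeff, Ultradiff.taylorCoeff]
  congr 1
  exact hfh.listDeriv _ hA ha

theorem contDiffOn_taylorCoeff (hΩ : IsOpen Ω) (hf : ContDiffOn ℝ ∞ f Ω) (k : Fin n → ℕ) :
    ContDiffOn ℝ ∞ (taylorCoeff f k) Ω :=
  (contDiffOn_listDeriv hΩ hf _ k).div_const _

theorem prod_factorial_add_single (k : Fin n → ℕ) (j : Fin n) :
    ∏ i, ((k + Pi.single j 1 : Fin n → ℕ) i).factorial = (k j + 1) * ∏ i, (k i).factorial := by
  rw [← Finset.mul_prod_erase Finset.univ _ (Finset.mem_univ j),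
    ← Finset.mul_prod_erase Finset.univ (fun i => (k i).factorial) (Finset.mem_univ j), ← mul_assoc]
  congr 1
  · simp [Nat.factorial_succ]
  · refine Finset.prod_congr rfl fun i hi => ?_
    simp [Finset.ne_of_mem_erase hi]

theorem taylorCoeff_partialDeriv (hΩ : IsOpen Ω) (hf : ContDiffOn ℝ ∞ f Ω) (k : Fin n → ℕ)
    (j : Fin n) {a : Fin n → ℝ} (ha : a ∈ Ω) :
    taylorCoeff (partialDeriv j f) k a = taylorCoeff f (k + Pi.single j 1) a * (k j + 1) := by
  rw [taylorCoeff, taylorCoeff, mixedDeriv_add_single hΩ hf k j ha, prod_factorial_add_single]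
  have : ((∏ i, (k i).factorial : ℕ) : ℝ) ≠ 0 := by
    exact_mod_cast (Finset.prod_pos fun i _ => Nat.factorial_pos _).ne'
  push_cast at this ⊢
  field_simp

theorem partialDeriv_taylorCoeff (hΩ : IsOpen Ω) (hf : ContDiffOn ℝ ∞ f Ω) (k : Fin n → ℕ)
    (j : Fin n) :
    EqOn (partialDeriv j (taylorCoeff f k)) (taylorCoeff (partialDeriv j f) k) Ω := by
  intro a ha
  have hm : ContDiffOn ℝ ∞ (mixedDeriv k f) Ω := contDiffOn_listDeriv hΩ hf _ k
  have hd := hm.differentiableAt_of_isOpen hΩ ha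
  rw [partialDeriv_eq_fderiv
    ((contDiffOn_taylorCoeff hΩ hf k).differentiableAt_of_isOpen hΩ ha), taylorCoeff]
  have e := partialDeriv_listDeriv hΩ hf (List.finRange n) k j ha
  change partialDeriv j (mixedDeriv k f) a = mixedDeriv k (partialDeriv j f) a at e
  rw [← e, partialDeriv_eq_fderiv hd]
  have : taylorCoeff f k
      = fun x => (((∏ i, (k i).factorial : ℕ) : ℝ))⁻¹ • mixedDeriv k f x := by
    funext x
    rw [taylorCoeff, smul_eq_mul, div_eq_inv_mul]
  rw [this, fderiv_fun_const_smul hd]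
  simp [div_eq_inv_mul]

end PartialDeriv

/-! ### The Taylor series as a ring homomorphism -/

section TaylorSeries

open MvPowerSeries

variable {n : ℕ} {Ω : Set (Fin n → ℝ)} {f h : (Fin n → ℝ) → ℝ} {a : Fin n → ℝ}

/-- The formal Taylor series of `f` at `a`. -/
def taylorSeries (a : Fin n → ℝ) (f : (Fin n → ℝ) → ℝ) : MvPowerSeries (Fin n) ℝ :=
  fun κ => taylorCoeff f κ a

theorem coeff_taylorSeries (κ : Fin n →₀ ℕ) : coeff κ (taylorSeries a f) = taylorCoeff f κ a := rfl

theorem constantCoeff_taylorSeries : constantCoeff (taylorSeries a f) = f a := by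
  rw [← coeff_zero_eq_constantCoeff_apply, coeff_taylorSeries, Finsupp.coe_zero, taylorCoeff_zero]

theorem taylorSeries_congr (hΩ : IsOpen Ω) (hfh : EqOn f h Ω) (ha : a ∈ Ω) :
    taylorSeries a f = taylorSeries a h := by
  ext κ
  exact hfh.taylorCoeff (fun i _ => hΩ.openAlong i) ha

/-- The ratio of the factorials is the factor of formal differentiation. Identities of Taylor series
can therefore be proved by induction on the degree, with no multinomial formulas. -/
theorem pderiv_taylorSeries (hΩ : IsOpen Ω) (hf : ContDiffOn ℝ ∞ f Ω) (ha : a ∈ Ω) (i : Fin n) :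
    pderiv ℝ i (taylorSeries a f) = taylorSeries a (partialDeriv i f) := by
  ext κ
  rw [coeff_pderiv, coeff_taylorSeries, coeff_taylorSeries, taylorCoeff_partialDeriv hΩ hf _ _ ha,
    Finsupp.coe_add, Finsupp.single_eq_pi_single]

/-- Induction on the degree of a coefficient, through partial derivatives. -/
theorem coeff_eq_of_coeff_pderiv_eq {F G : MvPowerSeries (Fin n) ℝ} {κ : Fin n →₀ ℕ} {i : Fin n}
    (h : coeff κ (pderiv ℝ i F) = coeff κ (pderiv ℝ i G)) :
    coeff (κ + Finsupp.single i 1) F = coeff (κ + Finsupp.single i 1) G := by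
  rw [coeff_pderiv, coeff_pderiv] at h
  exact mul_right_cancel₀ (by positivity) h

theorem _root_.Finsupp.eq_zero_or_exists_add_single (κ : Fin n →₀ ℕ) :
    κ = 0 ∨ ∃ κ' i, κ = κ' + Finsupp.single i 1 := by
  refine or_iff_not_imp_left.2 fun hκ => ?_
  obtain ⟨i, hi⟩ := Finsupp.ne_iff.1 hκ
  refine ⟨κ - Finsupp.single i 1, i, (tsub_add_cancel_of_le ?_).symm⟩
  exact Finsupp.single_le_iff.2 (Nat.one_le_iff_ne_zero.2 hi)

theorem contDiffOn_pi_add (hf : ContDiffOn ℝ ∞ f Ω) (hh : ContDiffOn ℝ ∞ h Ω) :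
    ContDiffOn ℝ ∞ (f + h) Ω := hf.add hh

theorem contDiffOn_pi_mul (hf : ContDiffOn ℝ ∞ f Ω) (hh : ContDiffOn ℝ ∞ h Ω) :
    ContDiffOn ℝ ∞ (f * h) Ω := hf.mul hh

theorem partialDeriv_add (hΩ : IsOpen Ω) (hf : ContDiffOn ℝ ∞ f Ω) (hh : ContDiffOn ℝ ∞ h Ω)
    (i : Fin n) : EqOn (partialDeriv i (f + h)) (partialDeriv i f + partialDeriv i h) Ω := by
  intro a ha
  have h1 := hf.differentiableAt_of_isOpen hΩ ha
  have h2 := hh.differentiableAt_of_isOpen hΩ ha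
  rw [partialDeriv_eq_fderiv (h1.add h2), Pi.add_apply, partialDeriv_eq_fderiv h1,
    partialDeriv_eq_fderiv h2, fderiv_add h1 h2]
  rfl

theorem partialDeriv_mul (hΩ : IsOpen Ω) (hf : ContDiffOn ℝ ∞ f Ω) (hh : ContDiffOn ℝ ∞ h Ω)
    (i : Fin n) :
    EqOn (partialDeriv i (f * h)) (f * partialDeriv i h + h * partialDeriv i f) Ω := by
  intro a ha
  have h1 := hf.differentiableAt_of_isOpen hΩ ha
  have h2 := hh.differentiableAt_of_isOpen hΩ ha
  rw [partialDeriv_eq_fderiv (h1.mul h2), Pi.add_apply, Pi.mul_apply, Pi.mul_apply,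
    partialDeriv_eq_fderiv h1, partialDeriv_eq_fderiv h2, fderiv_mul h1 h2]
  rfl

theorem taylorSeries_add (hΩ : IsOpen Ω) (hf : ContDiffOn ℝ ∞ f Ω) (hh : ContDiffOn ℝ ∞ h Ω)
    (ha : a ∈ Ω) : taylorSeries a (f + h) = taylorSeries a f + taylorSeries a h := by
  ext κ
  induction hd : κ.degree generalizing κ f h with
  | zero =>
    rw [Finsupp.degree_eq_zero_iff] at hd
    simp [hd, constantCoeff_taylorSeries]
  | succ d ih =>
    rcases κ.eq_zero_or_exists_add_single with rfl | ⟨κ, i, rfl⟩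
    · simp at hd
    refine coeff_eq_of_coeff_pderiv_eq ?_
    rw [pderiv_taylorSeries hΩ (contDiffOn_pi_add hf hh) ha, taylorSeries_congr hΩ (partialDeriv_add hΩ hf hh i) ha,
      map_add, pderiv_taylorSeries hΩ hf ha, pderiv_taylorSeries hΩ hh ha]
    exact ih (contDiffOn_partialDeriv hΩ hf i) (contDiffOn_partialDeriv hΩ hh i) κ
      (by simpa using hd)

/-- Both sides obey the Leibniz rule, so a coefficient of degree `d + 1` reduces to degree `d` for
pairs with one factor differentiated. -/
theorem taylorSeries_mul (hΩ : IsOpen Ω) (hf : ContDiffOn ℝ ∞ f Ω) (hh : ContDiffOn ℝ ∞ h Ω)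
    (ha : a ∈ Ω) : taylorSeries a (f * h) = taylorSeries a f * taylorSeries a h := by
  ext κ
  induction hd : κ.degree generalizing κ f h with
  | zero =>
    rw [Finsupp.degree_eq_zero_iff] at hd
    simp [hd, constantCoeff_taylorSeries]
  | succ d ih =>
    rcases κ.eq_zero_or_exists_add_single with rfl | ⟨κ, i, rfl⟩
    · simp at hd
    refine coeff_eq_of_coeff_pderiv_eq ?_
    have hf' := contDiffOn_partialDeriv hΩ hf i
    have hh' := contDiffOn_partialDeriv hΩ hh i
    rw [pderiv_taylorSeries hΩ (contDiffOn_pi_mul hf hh) ha, taylorSeries_congr hΩ (partialDeriv_mul hΩ hf hh i) ha,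
      Derivation.leibniz, pderiv_taylorSeries hΩ hf ha, pderiv_taylorSeries hΩ hh ha,
      taylorSeries_add hΩ (contDiffOn_pi_mul hf hh') (contDiffOn_pi_mul hh hf') ha, map_add, map_add, smul_eq_mul, smul_eq_mul,
      ih hf hh' κ (by simpa using hd), ih hh hf' κ (by simpa using hd)]

theorem taylorSeries_const (c : ℝ) : taylorSeries a (fun _ => c) = C c := by
  have h0 : taylorSeries a (fun _ => 0) = 0 := by
    have := taylorSeries_add (a := a) (f := fun _ => 0) (h := fun _ => 0) isOpen_univ
      contDiffOn_const contDiffOn_const (mem_univ a)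
    have e : (fun _ : Fin n → ℝ => (0 : ℝ)) + (fun _ => 0) = fun _ => 0 := by ext; simp
    rw [e] at this
    simpa using this
  refine pderiv.ext (fun i => ?_) (by simp [constantCoeff_taylorSeries])
  have hp : partialDeriv i (fun _ => c) = fun _ : Fin n → ℝ => (0 : ℝ) := by
    funext x
    simp [partialDeriv, lineDeriv]
  rw [pderiv_taylorSeries isOpen_univ contDiffOn_const (mem_univ a), hp, h0, pderiv_C]

theorem taylorSeries_coord (i : Fin n) : taylorSeries a (fun x => x i - a i) = X i := by
  have hc : ContDiff ℝ ∞ fun x : Fin n → ℝ => x i - a i :=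
    (contDiff_apply ℝ ℝ i).sub contDiff_const
  refine pderiv.ext (fun j => ?_) (by simp [constantCoeff_taylorSeries])
  have hp : partialDeriv j (fun x => x i - a i)
      = fun _ : Fin n → ℝ => (Pi.single j 1 : Fin n → ℝ) i := by
    funext x
    have : HasFDerivAt (fun x : Fin n → ℝ => x i - a i)
        (ContinuousLinearMap.proj (R := ℝ) (φ := fun _ : Fin n => ℝ) i) x :=
      (hasFDerivAt_apply i x).sub_const _
    rw [partialDeriv_eq_fderiv this.differentiableAt, this.fderiv]
    rfl
  rw [pderiv_taylorSeries isOpen_univ hc.contDiffOn (mem_univ a), hp, taylorSeries_const]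
  by_cases hij : i = j
  · subst hij; simp
  · rw [pderiv_X_of_ne hij]; simp [hij]

/-- The functions that are smooth on `Ω`. -/
def smoothOn (Ω : Set (Fin n → ℝ)) : Subring ((Fin n → ℝ) → ℝ) where
  carrier := {f | ContDiffOn ℝ ∞ f Ω}
  mul_mem' := fun hf hh => ContDiffOn.mul hf hh
  add_mem' := fun hf hh => ContDiffOn.add hf hh
  one_mem' := contDiffOn_const
  zero_mem' := contDiffOn_const
  neg_mem' := fun hf => ContDiffOn.neg hf

/-- Taking the Taylor series at a point is a ring homomorphism. -/
def taylorHom (hΩ : IsOpen Ω) (ha : a ∈ Ω) : smoothOn Ω →+* MvPowerSeries (Fin n) ℝ where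
  toFun f := taylorSeries a f
  map_one' := (taylorSeries_const 1).trans (map_one C)
  map_zero' := (taylorSeries_const 0).trans (map_zero C)
  map_mul' f h := taylorSeries_mul hΩ f.2 h.2 ha
  map_add' f h := taylorSeries_add hΩ f.2 h.2 ha

theorem taylorSeries_sum (hΩ : IsOpen Ω) (ha : a ∈ Ω) {ι : Type*} (t : Finset ι)
    {F : ι → (Fin n → ℝ) → ℝ} (hF : ∀ i, ContDiffOn ℝ ∞ (F i) Ω) :
    taylorSeries a (∑ i ∈ t, F i) = ∑ i ∈ t, taylorSeries a (F i) := by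
  have e : ((∑ i ∈ t, (⟨F i, hF i⟩ : smoothOn Ω) : smoothOn Ω) : (Fin n → ℝ) → ℝ)
      = ∑ i ∈ t, F i := by simp
  rw [← e]
  exact map_sum (taylorHom hΩ ha) _ t

theorem taylorSeries_prod_pow (hΩ : IsOpen Ω) (ha : a ∈ Ω) {ι : Type*} (t : Finset ι)
    {F : ι → (Fin n → ℝ) → ℝ} (hF : ∀ i, ContDiffOn ℝ ∞ (F i) Ω) (k : ι → ℕ) :
    taylorSeries a (∏ i ∈ t, F i ^ k i) = ∏ i ∈ t, taylorSeries a (F i) ^ k i := by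
  have e : ((∏ i ∈ t, (⟨F i, hF i⟩ : smoothOn Ω) ^ k i : smoothOn Ω) : (Fin n → ℝ) → ℝ)
      = ∏ i ∈ t, F i ^ k i := by simp
  rw [← e]
  exact (map_prod (taylorHom hΩ ha) _ t).trans
    (Finset.prod_congr rfl fun i _ => map_pow (taylorHom hΩ ha) _ _)

end TaylorSeries

/-! ### Taylor coefficients of a composition -/

section Composition

open MvPowerSeries

variable {n p : ℕ} {Ω : Set (Fin p → ℝ)} {Ω' : Set (Fin n → ℝ)} {f : (Fin n → ℝ) → ℝ}
  {g : (Fin p → ℝ) → Fin n → ℝ} {a : Fin p → ℝ}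

theorem partialDeriv_comp (hΩ : IsOpen Ω) (hΩ' : IsOpen Ω') (hf : ContDiffOn ℝ ∞ f Ω')
    (hg : ContDiffOn ℝ ∞ g Ω) (hm : MapsTo g Ω Ω') (i : Fin p) :
    EqOn (partialDeriv i (f ∘ g))
      (∑ l, (partialDeriv l f ∘ g) * partialDeriv i (fun x => g x l)) Ω := by
  intro a ha
  have h1 := hf.differentiableAt_of_isOpen hΩ' (hm ha)
  have h2 := hg.differentiableAt_of_isOpen hΩ ha
  rw [partialDeriv_eq_fderiv (h1.comp a h2), fderiv_comp a h1 h2, ContinuousLinearMap.comp_apply,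
    Finset.sum_apply]
  conv_lhs => rw [← Finset.univ_sum_single (fderiv ℝ g a (Pi.single i 1)), map_sum]
  refine Finset.sum_congr rfl fun l _ => ?_
  rw [Pi.mul_apply, Function.comp_apply, partialDeriv_eq_fderiv h1,
    partialDeriv_eq_fderiv (differentiableAt_pi.1 h2 l), fderiv_apply h2, mul_comm, ← smul_eq_mul,
    ← map_smul, ← Pi.single_smul, smul_eq_mul, mul_one]
  rfl

/-- A function that is flat at `g a` stays flat under composition with `g`. -/
theorem coeff_taylorSeries_comp_eq_zero (hΩ : IsOpen Ω) (hΩ' : IsOpen Ω') (ha : a ∈ Ω)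
    (hg : ContDiffOn ℝ ∞ g Ω) (hm : MapsTo g Ω Ω') (hf : ContDiffOn ℝ ∞ f Ω') {N : ℕ}
    (hflat : ∀ μ : Fin n →₀ ℕ, μ.degree ≤ N → coeff μ (taylorSeries (g a) f) = 0)
    {κ : Fin p →₀ ℕ} (hκ : κ.degree ≤ N) : coeff κ (taylorSeries a (f ∘ g)) = 0 := by
  induction N generalizing f κ with
  | zero =>
    rw [Nat.le_zero, Finsupp.degree_eq_zero_iff] at hκ
    have := hflat 0 (by simp)
    rw [coeff_zero_eq_constantCoeff_apply, constantCoeff_taylorSeries] at this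
    simpa [hκ, constantCoeff_taylorSeries] using this
  | succ N ih =>
    rcases κ.eq_zero_or_exists_add_single with rfl | ⟨κ, i, rfl⟩
    · have := hflat 0 (by simp)
      rw [coeff_zero_eq_constantCoeff_apply, constantCoeff_taylorSeries] at this
      simpa [constantCoeff_taylorSeries] using this
    rw [← map_zero (coeff (κ + Finsupp.single i 1))]
    refine coeff_eq_of_coeff_pderiv_eq ?_
    have hgl : ∀ l, ContDiffOn ℝ ∞ (fun x => g x l) Ω := fun l => contDiffOn_pi.1 hg l
    have hpc : ∀ l, ContDiffOn ℝ ∞ (partialDeriv l f ∘ g) Ω := fun l =>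
      (contDiffOn_partialDeriv hΩ' hf l).comp hg hm
    rw [pderiv_taylorSeries hΩ (hf.comp hg hm) ha,
      taylorSeries_congr hΩ (partialDeriv_comp hΩ hΩ' hf hg hm i) ha,
      taylorSeries_sum hΩ ha _ fun l => contDiffOn_pi_mul (hpc l) (contDiffOn_partialDeriv hΩ (hgl l) i),
      map_sum, map_zero, map_zero]
    refine Finset.sum_eq_zero fun l _ => ?_
    rw [taylorSeries_mul hΩ (hpc l) (contDiffOn_partialDeriv hΩ (hgl l) i) ha, coeff_mul]
    refine Finset.sum_eq_zero fun x hx => ?_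
    -- By the chain rule the induction passes to `∂_l f`, which is flat to one order less, and only
    -- coefficients of degree at most `N` occur.
    rw [ih (contDiffOn_partialDeriv hΩ' hf l) (fun μ hμ => ?_) (κ := x.1) ?_, zero_mul]
    · have := congrArg Finsupp.degree (Finset.HasAntidiagonal.mem_antidiagonal.1 hx)
      simp only [map_add, Finsupp.degree_single] at this hκ
      omega
    · rw [← pderiv_taylorSeries hΩ' hf (hm ha), coeff_pderiv, hflat _ (by simpa using hμ), zero_mul]

/-- The formula of Faà di Bruno, in terms of powers of the Taylor series of `g`. -/
theorem coeff_taylorSeries_comp (hΩ : IsOpen Ω) (hΩ' : IsOpen Ω') (ha : a ∈ Ω)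
    (hg : ContDiffOn ℝ ∞ g Ω) (hm : MapsTo g Ω Ω') (hf : ContDiffOn ℝ ∞ f Ω')
    {κ : Fin p →₀ ℕ} {S : Finset (Fin n →₀ ℕ)}
    (hS : ∀ μ : Fin n →₀ ℕ, μ.degree ≤ κ.degree → μ ∈ S) :
    coeff κ (taylorSeries a (f ∘ g)) = ∑ μ ∈ S, taylorCoeff f μ (g a) *
      coeff κ (∏ i, taylorSeries a (fun x => g x i - g a i) ^ μ i) := by
  have hgl : ∀ l, ContDiffOn ℝ ∞ (fun x => g x l - g a l) Ω := fun l =>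
    (contDiffOn_pi.1 hg l).sub contDiffOn_const
  have hid : ∀ l, ContDiffOn ℝ ∞ (fun x : Fin n → ℝ => x l - g a l) Ω' := fun l =>
    ((contDiff_apply ℝ ℝ l).sub contDiff_const).contDiffOn
  have hid' : ∀ μ : Fin n →₀ ℕ,
      ContDiffOn ℝ ∞ (∏ i, (fun x : Fin n → ℝ => x i - g a i) ^ μ i) Ω' := fun μ =>
    contDiffOn_prod' fun i _ => (hid i).pow _
  -- `P` is a Taylor polynomial of `f` at `g a`. The remainder `f - P` is flat to order `|κ|` and
  -- drops out, while `P ∘ g` is a polynomial in the `g_i - g_i(a)`.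
  let P : (Fin n → ℝ) → ℝ := ∑ μ ∈ S, (fun _ => taylorCoeff f μ (g a)) *
    ∏ i, (fun x : Fin n → ℝ => x i - g a i) ^ μ i
  have hP : ContDiffOn ℝ ∞ P Ω' := by
    have : ∀ S : Finset (Fin n →₀ ℕ), ContDiffOn ℝ ∞ (∑ μ ∈ S, (fun _ => taylorCoeff f μ (g a)) *
        ∏ i, (fun x : Fin n → ℝ => x i - g a i) ^ μ i) Ω' := fun S =>
      (smoothOn Ω').sum_mem fun μ _ => contDiffOn_pi_mul contDiffOn_const (hid' μ)
    exact this S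
  have hPT : taylorSeries (g a) P
      = ∑ μ ∈ S, C (taylorCoeff f μ (g a)) * monomial μ 1 := by
    rw [taylorSeries_sum hΩ' (hm ha) S fun μ => contDiffOn_pi_mul contDiffOn_const (hid' μ)]
    refine Finset.sum_congr rfl fun μ _ => ?_
    rw [taylorSeries_mul hΩ' contDiffOn_const (hid' μ) (hm ha), taylorSeries_const,
      taylorSeries_prod_pow hΩ' (hm ha) _ hid]
    simp_rw [taylorSeries_coord, monomial_one_eq]
    rw [Finsupp.prod_fintype _ _ (by simp)]
  have hPg : P ∘ g = ∑ μ ∈ S, (fun _ => taylorCoeff f μ (g a)) *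
      ∏ i, (fun x => g x i - g a i) ^ μ i := by
    funext x
    simp [P]
  have hPgT : coeff κ (taylorSeries a (P ∘ g)) = ∑ μ ∈ S, taylorCoeff f μ (g a) *
      coeff κ (∏ i, taylorSeries a (fun x => g x i - g a i) ^ μ i) := by
    have hpr : ∀ μ : Fin n →₀ ℕ, ContDiffOn ℝ ∞ (∏ i, (fun x => g x i - g a i) ^ μ i) Ω := fun μ =>
      contDiffOn_prod' fun i _ => (hgl i).pow _
    rw [hPg, taylorSeries_sum hΩ ha S fun μ => contDiffOn_pi_mul contDiffOn_const (hpr μ), map_sum]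
    refine Finset.sum_congr rfl fun μ _ => ?_
    rw [taylorSeries_mul hΩ contDiffOn_const (hpr μ) ha, taylorSeries_const,
      taylorSeries_prod_pow hΩ ha _ hgl, coeff_C_mul]
  have hneg : ContDiffOn ℝ ∞ (fun _ => (-1 : ℝ) : (Fin n → ℝ) → ℝ) Ω' := contDiffOn_const
  have hR : ContDiffOn ℝ ∞ (f + (fun _ => -1) * P) Ω' := hf.add (contDiffOn_pi_mul hneg hP)
  have hzero := coeff_taylorSeries_comp_eq_zero hΩ hΩ' ha hg hm hR (N := κ.degree) (κ := κ)
    (fun μ hμ => by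
      classical
      rw [taylorSeries_add hΩ' hf (contDiffOn_pi_mul hneg hP) (hm ha), taylorSeries_mul hΩ' hneg hP (hm ha),
        taylorSeries_const, hPT, map_add, coeff_C_mul, map_sum, coeff_taylorSeries]
      simp_rw [coeff_C_mul, coeff_monomial, mul_ite, mul_one, mul_zero]
      rw [Finset.sum_ite_eq S μ, if_pos (hS μ hμ)]
      ring) le_rfl
  have hsplit : (f + (fun _ => (-1 : ℝ)) * P) ∘ g = f ∘ g + (fun _ => (-1 : ℝ)) * (P ∘ g) := rfl
  have hneg' : ContDiffOn ℝ ∞ (fun _ => (-1 : ℝ) : (Fin p → ℝ) → ℝ) Ω := contDiffOn_const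
  rw [hsplit, taylorSeries_add hΩ (hf.comp hg hm) (contDiffOn_pi_mul hneg' (hP.comp hg hm)) ha,
    taylorSeries_mul hΩ hneg' (hP.comp hg hm) ha, taylorSeries_const, map_add, coeff_C_mul,
    hPgT] at hzero
  linarith

end Composition

/-! ### Weighted coefficient sums and the FdB inequality -/

section WeightedSums

open MvPowerSeries

variable {n : ℕ}

/-- The nonzero multiindices below `μ`. -/
def multiindexBox (μ : Fin n →₀ ℕ) : Finset (Fin n →₀ ℕ) := (Finset.Iic μ).erase 0

theorem mem_multiindexBox {μ κ : Fin n →₀ ℕ} : κ ∈ multiindexBox μ ↔ κ ≠ 0 ∧ κ ≤ μ := by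
  simp [multiindexBox]

/-- The weighted sum of the coefficients of a power series with exponents in a finite set. -/
def coeffSum (w : (Fin n → ℕ) → ℝ) (ρ : ℝ) (K : Finset (Fin n →₀ ℕ))
    (F : MvPowerSeries (Fin n) ℝ) : ℝ :=
  ∑ κ ∈ K, |coeff κ F| / w κ * ρ ^ κ.degree

variable {w : (Fin n → ℕ) → ℝ} {ρ c : ℝ}

theorem coeffSum_nonneg (hw : ∀ k, 0 < w k) (hρ : 0 ≤ ρ) (K : Finset (Fin n →₀ ℕ))
    (F : MvPowerSeries (Fin n) ℝ) : 0 ≤ coeffSum w ρ K F :=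
  Finset.sum_nonneg fun κ _ => by have := hw κ; positivity

/-- The FdB condition lists `|l|` factors in a row. This list takes the `i`-th factor `l i` times.
-/
theorem prod_comp_finSigmaFinEquiv {M : Type*} [CommMonoid M] (l : Fin n → ℕ) (F : Fin n → M) :
    ∏ j : Fin (∑ i, l i), F (finSigmaFinEquiv.symm j).1 = ∏ i, F i ^ l i := by
  rw [finSigmaFinEquiv.symm.prod_comp (fun x : (i : Fin n) × Fin (l i) => F x.1),
    Fintype.prod_sigma]
  simp

/-- This is the contribution of one decomposition of `κ`. If all parts are nonzero, the FdB
condition applies; otherwise the product vanishes for lack of constant terms. -/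
theorem weight_mul_prod_le (hw : ∀ k, 0 < w k) (hρ : 0 ≤ ρ) (hc : 0 ≤ c) {r : ℕ} {b : ℝ}
    {d : Fin r → MvPowerSeries (Fin n) ℝ} (hd : ∀ j, constantCoeff (d j) = 0)
    (hb : ∀ k : Fin r → Fin n →₀ ℕ, (∀ j, k j ≠ 0) →
      b * ∏ j, w (k j) ≤ c ^ r * w ⇑(∑ j, k j)) (κ : Fin n →₀ ℕ) (k : Fin r → Fin n →₀ ℕ)
    (hk : ∑ j, k j = κ) :
    b * (|∏ j, coeff (k j) (d j)| / w κ * ρ ^ κ.degree)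
      ≤ c ^ r * ∏ j, (|coeff (k j) (d j)| / w (k j) * ρ ^ (k j).degree) := by
  by_cases h0 : ∀ j, k j ≠ 0
  · have hP : 0 < ∏ j, w (k j) := Finset.prod_pos fun j _ => hw _
    have h1 : b / w κ ≤ c ^ r / ∏ j, w (k j) := by
      rw [div_le_div_iff₀ (hw _) hP, ← hk]
      exact hb k h0
    have h2 : ρ ^ κ.degree = ∏ j, ρ ^ (k j).degree := by
      rw [← hk, map_sum, Finset.prod_pow_eq_pow_sum]
    rw [Finset.prod_mul_distrib, Finset.prod_div_distrib, ← Finset.abs_prod, h2]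
    have h3 : 0 ≤ ∏ j, ρ ^ (k j).degree := Finset.prod_nonneg fun j _ => by positivity
    calc b * (|∏ j, coeff (k j) (d j)| / w κ * ∏ j, ρ ^ (k j).degree)
        = b / w κ * (|∏ j, coeff (k j) (d j)| * ∏ j, ρ ^ (k j).degree) := by ring
      _ ≤ (c ^ r / ∏ j, w (k j)) * (|∏ j, coeff (k j) (d j)| * ∏ j, ρ ^ (k j).degree) :=
          mul_le_mul_of_nonneg_right h1 (by positivity)
      _ = _ := by ring
  · push Not at h0
    obtain ⟨j, hj⟩ := h0
    have : ∏ j, coeff (k j) (d j) = 0 := Finset.prod_eq_zero (Finset.mem_univ j) (by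
      rw [hj, coeff_zero_eq_constantCoeff_apply, hd])
    rw [this]
    simp only [abs_zero, zero_div, zero_mul, mul_zero]
    refine mul_nonneg (by positivity) (Finset.prod_nonneg fun j _ => ?_)
    have := hw (k j)
    positivity

/-- Expanding the product gives a sum over decompositions, each estimated separately. Dropping the
constraint on the sum of the parts lets the total factor. The number `b` stands for `w l`, so that
the factors can be indexed by `Fin r`. -/
theorem mul_coeffSum_prod_le (hw : ∀ k, 0 < w k) (hρ : 0 ≤ ρ) (hc : 0 ≤ c) {r : ℕ} {b : ℝ}
    (hb0 : 0 ≤ b) {d : Fin r → MvPowerSeries (Fin n) ℝ} (hd : ∀ j, constantCoeff (d j) = 0)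
    (hb : ∀ k : Fin r → Fin n →₀ ℕ, (∀ j, k j ≠ 0) →
      b * ∏ j, w (k j) ≤ c ^ r * w ⇑(∑ j, k j)) (μ : Fin n →₀ ℕ) :
    b * coeffSum w ρ (multiindexBox μ) (∏ j, d j)
      ≤ c ^ r * ∏ j, coeffSum w ρ (multiindexBox μ) (d j) := by
  classical
  set K := multiindexBox μ
  let t : (Fin r → Fin n →₀ ℕ) → ℝ :=
    fun k => ∏ j, (|coeff (k j) (d j)| / w (k j) * ρ ^ (k j).degree)
  have ht : ∀ k, 0 ≤ t k := fun k => Finset.prod_nonneg fun j _ => by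
    have := hw (k j); positivity
  have hterm : ∀ κ ∈ K, b * (|coeff κ (∏ j, d j)| / w κ * ρ ^ κ.degree)
      ≤ c ^ r * ∑ k ∈ Fintype.piFinset fun _ : Fin r => K, if ∑ j, k j = κ then t k else 0 := by
    intro κ hκ
    rw [coeff_prod]
    have h1 : b * (|∑ l ∈ Finset.finsuppAntidiag Finset.univ κ, ∏ j, coeff (l j) (d j)| / w κ
          * ρ ^ κ.degree)
        ≤ ∑ l ∈ Finset.finsuppAntidiag Finset.univ κ,
          b * (|∏ j, coeff (l j) (d j)| / w κ * ρ ^ κ.degree) := by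
      rw [← Finset.mul_sum, ← Finset.sum_mul, ← Finset.sum_div]
      have := hw κ
      gcongr
      exact Finset.abs_sum_le_sum_abs _ _
    have h2 : ∀ l ∈ Finset.finsuppAntidiag Finset.univ κ,
        b * (|∏ j, coeff (l j) (d j)| / w κ * ρ ^ κ.degree)
        ≤ c ^ r * if ∀ j, l j ∈ K then t l else 0 := by
      intro l hl
      have hsum : ∑ j, l j = κ := (Finset.mem_finsuppAntidiag.1 hl).1
      split_ifs with hK
      · exact weight_mul_prod_le hw hρ hc hd hb κ l hsum
      · push Not at hK
        obtain ⟨j, hj⟩ := hK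
        -- Parts of `κ` are below `μ`, so a part outside the box can only be zero.
        have hj0 : l j = 0 := by
          by_contra h
          refine hj (mem_multiindexBox.2 ⟨h, le_trans ?_ (mem_multiindexBox.1 hκ).2⟩)
          rw [← hsum]
          exact Finset.single_le_sum (f := fun j => l j) (fun _ _ => zero_le) (Finset.mem_univ j)
        have : ∏ j, coeff (l j) (d j) = 0 := Finset.prod_eq_zero (Finset.mem_univ j) (by
          rw [hj0, coeff_zero_eq_constantCoeff_apply, hd])
        simp [this]
    refine h1.trans ((Finset.sum_le_sum h2).trans ?_)
    rw [← Finset.mul_sum, ← Finset.sum_filter, ← Finset.sum_filter]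
    refine mul_le_mul_of_nonneg_left ?_ (by positivity)
    rw [← Finset.sum_image (f := t) (g := fun l : Fin r →₀ Fin n →₀ ℕ => ⇑l)
      (DFunLike.coe_injective.injOn)]
    refine Finset.sum_le_sum_of_subset_of_nonneg (fun k hk => ?_) fun k _ _ => ht k
    obtain ⟨l, hl, rfl⟩ := Finset.mem_image.1 hk
    rw [Finset.mem_filter] at hl ⊢
    exact ⟨Fintype.mem_piFinset.2 hl.2, (Finset.mem_finsuppAntidiag.1 hl.1).1⟩
  calc b * coeffSum w ρ K (∏ j, d j)
      = ∑ κ ∈ K, b * (|coeff κ (∏ j, d j)| / w κ * ρ ^ κ.degree) := Finset.mul_sum _ _ _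
    _ ≤ ∑ κ ∈ K, c ^ r * ∑ k ∈ Fintype.piFinset fun _ : Fin r => K,
          if ∑ j, k j = κ then t k else 0 := Finset.sum_le_sum hterm
    _ = c ^ r * ∑ k ∈ Fintype.piFinset fun _ : Fin r => K, ∑ κ ∈ K,
          if ∑ j, k j = κ then t k else 0 := by rw [← Finset.mul_sum, Finset.sum_comm]
    _ ≤ c ^ r * ∑ k ∈ Fintype.piFinset fun _ : Fin r => K, t k := by
        refine mul_le_mul_of_nonneg_left (Finset.sum_le_sum fun k _ => ?_) (by positivity)
        rw [Finset.sum_ite_eq]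
        split_ifs
        exacts [le_rfl, ht k]
    _ = c ^ r * ∏ j, coeffSum w ρ K (d j) := by
        simp only [coeffSum]
        rw [Finset.prod_univ_sum]

/-- The inequality in the definition of a strictly Faà di Bruno weight, with a given constant. -/
def FdBBound (w : (Fin n → ℕ) → ℝ) (c : ℝ) : Prop :=
  ∀ l : Fin n → ℕ, l ≠ 0 → ∀ k : Fin (∑ i, l i) → Fin n → ℕ, (∀ j, k j ≠ 0) →
    w l * ∏ j, w (k j) ≤ c ^ (∑ i, l i) * w (∑ j, k j)

theorem mul_coeffSum_prod_pow_le (hw : ∀ k, 0 < w k) (hρ : 0 ≤ ρ) (hc : 0 ≤ c)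
    (hF : FdBBound w c) {H : Fin n → MvPowerSeries (Fin n) ℝ}
    (hH : ∀ i, constantCoeff (H i) = 0) {l : Fin n →₀ ℕ} (hl : l ≠ 0) (μ : Fin n →₀ ℕ) :
    w l * coeffSum w ρ (multiindexBox μ) (∏ i, H i ^ l i)
      ≤ c ^ l.degree * ∏ i, coeffSum w ρ (multiindexBox μ) (H i) ^ l i := by
  rw [← prod_comp_finSigmaFinEquiv (fun i => l i), ← prod_comp_finSigmaFinEquiv (fun i => l i),
    Finsupp.degree_eq_sum]
  refine mul_coeffSum_prod_le hw hρ hc (hw _).le (fun j => hH _) (fun k hk => ?_) μ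
  have := hF l (by simpa using hl) (fun j => k j) (fun j => by simpa using hk j)
  rwa [← Finsupp.coe_finsetSum] at this

theorem sum_half_pow_le (n M : ℕ) :
    ∑ l ∈ Fintype.piFinset fun _ : Fin n => Finset.range (M + 1), (1 / 2 : ℝ) ^ (∑ i, l i)
      ≤ 2 ^ n := by
  have h1 : ∑ j ∈ Finset.range (M + 1), (1 / 2 : ℝ) ^ j ≤ 2 := by
    have := sum_geometric_two_le (M + 1)
    simpa using this
  calc ∑ l ∈ Fintype.piFinset fun _ : Fin n => Finset.range (M + 1), (1 / 2 : ℝ) ^ (∑ i, l i)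
      = ∏ _i : Fin n, ∑ j ∈ Finset.range (M + 1), (1 / 2 : ℝ) ^ j := by
        rw [Finset.prod_univ_sum]
        exact Finset.sum_congr rfl fun l _ => (Finset.prod_pow_eq_pow_sum _ _ _).symm
    _ ≤ ∏ _i : Fin n, (2 : ℝ) :=
        Finset.prod_le_prod (fun _ _ => Finset.sum_nonneg fun _ _ => by positivity) fun _ _ => h1
    _ = 2 ^ n := by simp

/-- The weighted Faà di Bruno inequality: a composition `f ∘ g` is controlled linearly by `g`, as
long as `g` is small compared to the radius of convergence of the bounds for `f`. -/
theorem coeffSum_comp_le (hw : ∀ k, 0 < w k) (hρ : 0 ≤ ρ) (hc : 0 ≤ c) (hF : FdBBound w c)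
    {Ω Ω' : Set (Fin n → ℝ)} {f : (Fin n → ℝ) → ℝ} {g : (Fin n → ℝ) → Fin n → ℝ} {a : Fin n → ℝ}
    (hΩ : IsOpen Ω) (hΩ' : IsOpen Ω') (ha : a ∈ Ω) (hg : ContDiffOn ℝ ∞ g Ω) (hm : MapsTo g Ω Ω')
    (hf : ContDiffOn ℝ ∞ f Ω') {C R : ℝ} (hC : 0 ≤ C) (hR : 0 ≤ R)
    (hfb : ∀ l : Fin n →₀ ℕ, l ≠ 0 → |taylorCoeff f l (g a)| ≤ C * w l * R ^ l.degree)
    (μ : Fin n →₀ ℕ) {G : ℝ}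
    (hG : ∑ i, coeffSum w ρ (multiindexBox μ) (taylorSeries a fun x => g x i) ≤ G)
    (hsmall : 2 * c * R * G ≤ 1) :
    coeffSum w ρ (multiindexBox μ) (taylorSeries a (f ∘ g)) ≤ C * 2 ^ (n + 1) * c * R * G := by
  classical
  set K := multiindexBox μ
  let H : Fin n → MvPowerSeries (Fin n) ℝ := fun i => taylorSeries a fun x => g x i - g a i
  have hH0 : ∀ i, constantCoeff (H i) = 0 := fun i => by
    simp [H, constantCoeff_taylorSeries]
  have hHK : ∀ i, coeffSum w ρ K (H i) = coeffSum w ρ K (taylorSeries a fun x => g x i) := by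
    intro i
    refine Finset.sum_congr rfl fun κ hκ => ?_
    -- Centring `g` changes only the constant coefficient, which the box omits.
    have e : H i = (taylorSeries a fun x => g x i) + MvPowerSeries.C (-g a i) := by
      rw [← taylorSeries_const (a := a),
        ← taylorSeries_add hΩ (contDiffOn_pi.1 hg i) contDiffOn_const ha]
      rfl
    rw [e, map_add, coeff_C, if_neg (mem_multiindexBox.1 hκ).1, add_zero]
  have hHnn : ∀ i, 0 ≤ coeffSum w ρ K (H i) := fun i => coeffSum_nonneg hw hρ K _
  have hHG : ∀ i, coeffSum w ρ K (H i) ≤ G := by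
    intro i
    refine le_trans ?_ hG
    rw [← Finset.sum_congr rfl fun i _ => hHK i]
    exact Finset.single_le_sum (f := fun i => coeffSum w ρ K (H i)) (fun i _ => hHnn i)
      (Finset.mem_univ i)
  have hG0 : 0 ≤ G := le_trans (Finset.sum_nonneg fun i _ => coeffSum_nonneg hw hρ K _) hG
  let M := μ.degree
  let e : (Fin n → ℕ) ↪ (Fin n →₀ ℕ) := Finsupp.equivFunOnFinite.symm.toEmbedding
  -- A cube of exponents, rather than those of bounded degree, lets the geometric sum factor over
  -- coordinates.
  let S : Finset (Fin n →₀ ℕ) := (Fintype.piFinset fun _ : Fin n => Finset.range (M + 1)).map e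
  have hS : ∀ κ ∈ K, ∀ l : Fin n →₀ ℕ, l.degree ≤ κ.degree → l ∈ S := by
    intro κ hκ l hl
    refine Finset.mem_map.2 ⟨l, Fintype.mem_piFinset.2 fun i => ?_, Finsupp.ext fun _ => rfl⟩
    rw [Finset.mem_range, Nat.lt_succ_iff]
    exact (Finsupp.le_degree i l).trans (hl.trans (Finsupp.degree_mono (mem_multiindexBox.1 hκ).2))
  have hcoef : ∀ κ ∈ K, |coeff κ (taylorSeries a (f ∘ g))|
      ≤ ∑ l ∈ S.erase 0, C * w l * R ^ l.degree * |coeff κ (∏ i, H i ^ l i)| := by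
    intro κ hκ
    rw [coeff_taylorSeries_comp hΩ hΩ' ha hg hm hf (hS κ hκ),
      ← Finset.add_sum_erase S _ (hS κ hκ 0 (by simp))]
    have h0 : coeff κ (∏ i, H i ^ (0 : Fin n →₀ ℕ) i) = 0 := by
      simp [coeff_one, (mem_multiindexBox.1 hκ).1]
    rw [h0, mul_zero, zero_add]
    refine (Finset.abs_sum_le_sum_abs _ _).trans (Finset.sum_le_sum fun l hl => ?_)
    rw [abs_mul]
    exact mul_le_mul_of_nonneg_right (hfb l (Finset.ne_of_mem_erase hl)) (abs_nonneg _)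
  have hx : ∀ l ∈ S.erase 0, C * R ^ l.degree *
        (w l * coeffSum w ρ K (∏ i, H i ^ l i)) ≤ C * (2 * c * R * G) * (1 / 2) ^ l.degree := by
    intro l hl
    have hl0 := Finset.ne_of_mem_erase hl
    have h1 := mul_coeffSum_prod_pow_le (ρ := ρ) hw hρ hc hF hH0 hl0 μ
    have h2 : ∏ i, coeffSum w ρ K (H i) ^ l i ≤ G ^ l.degree := by
      rw [Finsupp.degree_eq_sum, ← Finset.prod_pow_eq_pow_sum]
      exact Finset.prod_le_prod (fun i _ => pow_nonneg (hHnn i) _) fun i _ =>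
        pow_le_pow_left₀ (hHnn i) (hHG i) _
    -- Since `|l| ≥ 1`, one factor survives, which makes the bound linear in `G`. The factor `2` in
    -- the smallness condition pays for `(1 / 2) ^ |l|`.
    have h3 : (2 * c * R * G) ^ l.degree ≤ 2 * c * R * G :=
      pow_le_of_le_one (by positivity) hsmall (by rwa [Ne, Finsupp.degree_eq_zero_iff])
    calc C * R ^ l.degree * (w l * coeffSum w ρ K (∏ i, H i ^ l i))
        ≤ C * R ^ l.degree * (c ^ l.degree * G ^ l.degree) := by
          refine mul_le_mul_of_nonneg_left (h1.trans ?_) (by positivity)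
          exact mul_le_mul_of_nonneg_left h2 (by positivity)
      _ = C * (2 * c * R * G) ^ l.degree * (1 / 2) ^ l.degree := by
          rw [mul_assoc C, ← mul_pow, mul_assoc, ← mul_pow, ← mul_pow]
          congr 2
          ring
      _ ≤ C * (2 * c * R * G) * (1 / 2) ^ l.degree := by gcongr
  calc coeffSum w ρ K (taylorSeries a (f ∘ g))
      ≤ ∑ κ ∈ K, (∑ l ∈ S.erase 0, C * w l * R ^ l.degree * |coeff κ (∏ i, H i ^ l i)|) / w κ
          * ρ ^ κ.degree := by
        refine Finset.sum_le_sum fun κ hκ => ?_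
        have := hw κ
        gcongr
        exact hcoef κ hκ
    _ = ∑ l ∈ S.erase 0, C * R ^ l.degree * (w l * coeffSum w ρ K (∏ i, H i ^ l i)) := by
        simp_rw [coeffSum, Finset.sum_div, Finset.sum_mul, Finset.mul_sum]
        rw [Finset.sum_comm]
        exact Finset.sum_congr rfl fun l _ => Finset.sum_congr rfl fun κ _ => by ring
    _ ≤ ∑ l ∈ S.erase 0, C * (2 * c * R * G) * (1 / 2) ^ l.degree := Finset.sum_le_sum hx
    _ ≤ ∑ l ∈ S, C * (2 * c * R * G) * (1 / 2) ^ l.degree :=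
        Finset.sum_le_sum_of_subset_of_nonneg (Finset.erase_subset _ _) fun _ _ _ => by positivity
    _ = C * (2 * c * R * G) * ∑ l ∈ Fintype.piFinset fun _ : Fin n => Finset.range (M + 1),
          (1 / 2 : ℝ) ^ (∑ i, l i) := by
        rw [← Finset.mul_sum, Finset.sum_map]
        simp only [Finsupp.degree_eq_sum]
        rfl
    _ ≤ C * (2 * c * R * G) * 2 ^ n :=
        mul_le_mul_of_nonneg_left (sum_half_pow_le n M) (by positivity)
    _ = C * 2 ^ (n + 1) * c * R * G := by ring

end WeightedSums

/-! ### Local Taylor bounds and the class `E^w` -/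

section Bounds

open MvPowerSeries

variable {s n : ℕ} {w : (Fin n → ℕ) → ℝ}

/-- Bounds for the values and the Taylor coefficients of `v` at `x`. -/
def TaylorBound {p : ℕ} (w : (Fin n → ℕ) → ℝ) (v : (Fin n → ℝ) → Fin p → ℝ) (C R : ℝ)
    (x : Fin n → ℝ) : Prop :=
  ∀ i, |v x i| ≤ C ∧ ∀ l : Fin n →₀ ℕ, l ≠ 0 →
    |taylorCoeff (fun y => v y i) l x| ≤ C * w l * R ^ l.degree

theorem TaylorBound.mono {p : ℕ} {v : (Fin n → ℝ) → Fin p → ℝ} {C R C' R' : ℝ} {x : Fin n → ℝ}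
    (hw : ∀ k, 0 < w k) (h : TaylorBound w v C R x) (hC : 0 ≤ C) (hR : 0 ≤ R) (hCC : C ≤ C')
    (hRR : R ≤ R') : TaylorBound w v C' R' x := by
  refine fun i => ⟨(h i).1.trans hCC, fun l hl => ((h i).2 l hl).trans ?_⟩
  have := hw l
  have := hC.trans hCC
  gcongr

/-- Each term of the seminorm is below its supremum, giving `R = r⁻¹`. The values of `v`, which the
seminorm omits, are bounded by continuity. -/
theorem ClassE.exists_taylorBound {p : ℕ} {v : (Fin n → ℝ) → Fin p → ℝ} {Ω : Set (Fin n → ℝ)}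
    (hw : ∀ k, 0 < w k) (hΩ : IsOpen Ω) (hv : ClassE w v Ω) {a : Fin n → ℝ} (ha : a ∈ Ω) :
    ∃ C R : ℝ, 0 ≤ C ∧ 0 ≤ R ∧ ∀ᶠ x in 𝓝 a, TaylorBound w v C R x := by
  obtain ⟨U, hU, -, r, hr, hsup⟩ := hv.2 a ha
  set M := ⨆ x ∈ U, weightedSeminorm w v x r
  have hcont : ContinuousAt v a := (hv.1.continuousOn).continuousAt (hΩ.mem_nhds ha)
  have hbd : ∀ᶠ x in 𝓝 a, ‖v x‖ < ‖v a‖ + 1 :=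
    hcont.norm.eventually (gt_mem_nhds (lt_add_one _))
  refine ⟨max M.toReal (‖v a‖ + 1), r⁻¹, by positivity, by positivity, ?_⟩
  filter_upwards [hU, hbd] with x hx hxb i
  refine ⟨(norm_le_pi_norm (v x) i).trans (hxb.le.trans (le_max_right _ _)), fun l hl => ?_⟩
  have hl' : (⇑l : Fin n → ℕ) ≠ 0 := by simpa using hl
  have h1 : ENNReal.ofReal (|taylorCoeff (fun y => v y i) l x| / w l * r ^ (∑ i, l i)) ≤ M :=
    calc _ ≤ scalarSeminorm w (fun y => v y i) x r :=
          ENNReal.le_tsum (f := fun k : {k : Fin n → ℕ // k ≠ 0} =>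
            ENNReal.ofReal (|taylorCoeff (fun y => v y i) k.1 x| / w k.1 * r ^ (∑ i, k.1 i)))
            ⟨l, hl'⟩
      _ ≤ weightedSeminorm w v x r := le_iSup (fun i => scalarSeminorm w (fun y => v y i) x r) i
      _ ≤ M := le_iSup₂ (f := fun x (_ : x ∈ U) => weightedSeminorm w v x r) x hx
  rw [ENNReal.ofReal_le_iff_le_toReal hsup.ne, ← Finsupp.degree_eq_sum] at h1
  have hwl := hw l
  rw [div_mul_eq_mul_div, div_le_iff₀ hwl] at h1
  rw [inv_pow, ← div_eq_mul_inv, le_div_iff₀ (by positivity)]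
  exact h1.trans (by gcongr; exact le_max_left _ _)

theorem ClassE.exists_taylorBound_nhdsSet {p : ℕ} {v : (Fin n → ℝ) → Fin p → ℝ}
    {Ω K : Set (Fin n → ℝ)} (hw : ∀ k, 0 < w k) (hΩ : IsOpen Ω) (hv : ClassE w v Ω)
    (hK : IsCompact K) (hKΩ : K ⊆ Ω) :
    ∃ C R : ℝ, 0 ≤ C ∧ 0 ≤ R ∧ ∀ᶠ x in 𝓝ˢ K, TaylorBound w v C R x := by
  refine hK.induction_on (p := fun t => ∃ C R : ℝ, 0 ≤ C ∧ 0 ≤ R ∧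
    ∀ᶠ x in 𝓝ˢ t, TaylorBound w v C R x) ⟨0, 0, le_rfl, le_rfl, by simp⟩ ?_ ?_ ?_
  · rintro t t' htt ⟨C, R, hC, hR, h⟩
    exact ⟨C, R, hC, hR, h.filter_mono (nhdsSet_mono htt)⟩
  · rintro t t' ⟨C, R, hC, hR, h⟩ ⟨C', R', hC', hR', h'⟩
    refine ⟨max C C', max R R', le_max_of_le_left hC, le_max_of_le_left hR, ?_⟩
    rw [nhdsSet_union, Filter.eventually_sup]
    exact ⟨h.mono fun x hx => hx.mono hw hC hR (le_max_left _ _) (le_max_left _ _),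
      h'.mono fun x hx => hx.mono hw hC' hR' (le_max_right _ _) (le_max_right _ _)⟩
  · intro a ha
    obtain ⟨C, R, hC, hR, h⟩ := hv.exists_taylorBound hw hΩ (hKΩ ha)
    refine ⟨_, mem_nhdsWithin_of_mem_nhds h.eventually_nhds, C, R, hC, hR, ?_⟩
    exact eventually_nhdsSet_iff_forall.2 fun x hx => hx

theorem scalarSeminorm_le_of_coeffSum_le {f : (Fin n → ℝ) → ℝ} {a : Fin n → ℝ} {ρ B : ℝ}
    (hw : ∀ k, 0 < w k) (hρ : 0 ≤ ρ)
    (h : ∀ μ, coeffSum w ρ (multiindexBox μ) (taylorSeries a f) ≤ B) :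
    scalarSeminorm w f a ρ ≤ ENNReal.ofReal B := by
  rw [scalarSeminorm, ENNReal.tsum_eq_iSup_sum]
  refine iSup_le fun F => ?_
  have hnn : ∀ k : Fin n → ℕ, 0 ≤ |taylorCoeff f k a| / w k * ρ ^ (∑ i, k i) := fun k => by
    have := hw k; positivity
  rw [← ENNReal.ofReal_sum_of_nonneg fun k _ => hnn k.1]
  refine ENNReal.ofReal_le_ofReal ?_
  let e : {k : Fin n → ℕ // k ≠ 0} ↪ (Fin n →₀ ℕ) :=
    (Function.Embedding.subtype _).trans Finsupp.equivFunOnFinite.symm.toEmbedding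
  -- Every finite set of nonzero multiindices lies in the box below its sum.
  refine le_trans ?_ (h (∑ k ∈ F, e k))
  have : ∑ k ∈ F, |taylorCoeff f k a| / w k * ρ ^ (∑ i, k.1 i)
      = ∑ κ ∈ F.map e, |coeff κ (taylorSeries a f)| / w κ * ρ ^ κ.degree := by
    rw [Finset.sum_map]
    refine Finset.sum_congr rfl fun k _ => ?_
    rw [Finsupp.degree_eq_sum]
    rfl
  rw [this]
  refine Finset.sum_le_sum_of_subset_of_nonneg (fun κ hκ => ?_) fun κ _ _ => ?_
  · obtain ⟨k, hk, rfl⟩ := Finset.mem_map.1 hκ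
    refine mem_multiindexBox.2 ⟨fun h0 => k.2 ?_,
      Finset.single_le_sum (f := fun k => e k) (fun _ _ => zero_le) hk⟩
    exact congrArg (fun l : Fin n →₀ ℕ => (⇑l : Fin n → ℕ)) h0
  · have := hw κ; positivity

theorem taylorSeries_apply (a : Fin n → ℝ) (i : Fin n) :
    taylorSeries a (fun x => x i) = X i + MvPowerSeries.C (a i) := by
  have h1 : ContDiffOn ℝ ∞ (fun x : Fin n → ℝ => x i - a i) univ :=
    ((contDiff_apply ℝ ℝ i).sub contDiff_const).contDiffOn
  rw [← taylorSeries_coord (a := a), ← taylorSeries_const (a := a),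
    ← taylorSeries_add isOpen_univ h1 contDiffOn_const (mem_univ a)]
  congr 1
  funext x
  simp

theorem coeff_taylorSeries_apply (a : Fin n → ℝ) (i : Fin n) {κ : Fin n →₀ ℕ} (hκ : κ ≠ 0) :
    coeff κ (taylorSeries a fun x => x i) = if κ = Finsupp.single i 1 then 1 else 0 := by
  classical
  rw [taylorSeries_apply, map_add, coeff_C, if_neg hκ, add_zero, coeff_X]

theorem coeffSum_apply_le (hw : ∀ k, 0 < w k) {ρ : ℝ} (hρ : 0 ≤ ρ) (a : Fin n → ℝ) (i : Fin n)
    (μ : Fin n →₀ ℕ) :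
    coeffSum w ρ (multiindexBox μ) (taylorSeries a fun x => x i)
      ≤ ρ / w ⇑(Finsupp.single i 1) := by
  classical
  have : ∀ κ ∈ multiindexBox μ, |coeff κ (taylorSeries a fun x => x i)| / w κ * ρ ^ κ.degree
      = if κ = Finsupp.single i 1 then ρ / w ⇑(Finsupp.single i 1) else 0 := by
    intro κ hκ
    rw [coeff_taylorSeries_apply a i (mem_multiindexBox.1 hκ).1]
    split_ifs with h
    · subst h
      simp [div_eq_inv_mul]
    · simp
  rw [coeffSum, Finset.sum_congr rfl this, Finset.sum_ite_eq']
  have := hw ⇑(Finsupp.single i 1)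
  split_ifs
  exacts [le_rfl, by positivity]

/-- For boxes without time direction, the time component of the graph of the flow contributes
nothing, so the Gronwall inequality is homogeneous. -/
theorem coeffSum_apply_eq_zero {ρ : ℝ} (a : Fin n → ℝ) (i : Fin n) {μ : Fin n →₀ ℕ}
    (hμ : μ i = 0) : coeffSum w ρ (multiindexBox μ) (taylorSeries a fun x => x i) = 0 := by
  refine Finset.sum_eq_zero fun κ hκ => ?_
  rw [mem_multiindexBox] at hκ
  rw [coeff_taylorSeries_apply a i hκ.1, if_neg]
  · simp
  · rintro rfl
    have := hκ.2 i
    simp [hμ] at this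

/-- This is the FdB condition for `l = 2 e_i` and the two parts `κ` and `e_i`. -/
theorem FdBBound.exists_shift_le {w : (Fin n → ℕ) → ℝ} {c : ℝ} (hw : ∀ k, 0 < w k)
    (hF : FdBBound w c) (i : Fin n) :
    ∃ H : ℝ, 0 ≤ H ∧ ∀ κ : Fin n →₀ ℕ, κ ≠ 0 → w κ ≤ H * w ⇑(κ + Finsupp.single i 1 : Fin n →₀ ℕ) := by
  have h1 := hw (Pi.single i 1)
  have h2 := hw (Pi.single i 2)
  refine ⟨c ^ 2 / (w (Pi.single i 2) * w (Pi.single i 1)), by positivity, fun κ hκ => ?_⟩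
  have hl : (Pi.single i 2 : Fin n → ℕ) ≠ 0 := by simp
  have := hF _ hl
  have hr : ∑ j, (Pi.single i 2 : Fin n → ℕ) j = 2 := by simp
  rw [hr] at this
  have := this ![⇑κ, Pi.single i 1] (fun j => by
    fin_cases j
    · simpa using hκ
    · simp)
  simp only [Fin.prod_univ_two, Fin.sum_univ_two, Matrix.cons_val_zero, Matrix.cons_val_one] at this
  rw [div_mul_eq_mul_div, le_div_iff₀ (by positivity), Finsupp.coe_add,
    Finsupp.single_eq_pi_single]
  linarith

end Bounds

/-! ### Weighted estimates for the flow in space and in time -/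

section FlowEstimates

open MvPowerSeries

variable {s : ℕ} {w : (Fin (s + 1) → ℕ) → ℝ} {v : (Fin (s + 1) → ℝ) → Fin s → ℝ}
  {Ω : Set (Fin (s + 1) → ℝ)} {t₀ : ℝ} {ρ c C R : ℝ}

/-- The weighted sum of the Taylor coefficients of all components of the flow. -/
def flowSum (w : (Fin (s + 1) → ℕ) → ℝ) (ρ : ℝ) (μ : Fin (s + 1) →₀ ℕ)
    (v : (Fin (s + 1) → ℝ) → Fin s → ℝ) (Ω : Set (Fin (s + 1) → ℝ)) (t₀ : ℝ)
    (a : Fin (s + 1) → ℝ) : ℝ :=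
  ∑ i, coeffSum w ρ (multiindexBox μ) (taylorSeries a fun x => flow v Ω t₀ x i)

theorem sum_coeffSum_graphFlow (μ : Fin (s + 1) →₀ ℕ) (a : Fin (s + 1) → ℝ) :
    ∑ i, coeffSum w ρ (multiindexBox μ) (taylorSeries a fun x => graphFlow v Ω t₀ x i)
      = coeffSum w ρ (multiindexBox μ) (taylorSeries a fun x => x 0)
        + flowSum w ρ μ v Ω t₀ a := by
  rw [Fin.sum_univ_succ]
  rfl

theorem contDiffOn_flow_apply (hΩ : IsOpen Ω) (hv : ContDiffOn ℝ ∞ v Ω) (i : Fin s) :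
    ContDiffOn ℝ ∞ (fun x => flow v Ω t₀ x i) (flowDomain v Ω t₀) :=
  contDiffOn_pi.1 (contDiffOn_flow hΩ hv) i

theorem partialDeriv_flow (hΩ : IsOpen Ω) (hv : ContDiffOn ℝ ∞ v Ω) (i : Fin s) :
    EqOn (partialDeriv 0 fun x => flow v Ω t₀ x i) ((fun y => v y i) ∘ graphFlow v Ω t₀)
      (flowDomain v Ω t₀) := by
  intro a ha
  have hD := isOpen_flowDomain (t₀ := t₀) hΩ hv
  have hd := (contDiffOn_flow (t₀ := t₀) hΩ hv).differentiableAt_of_isOpen hD ha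
  rw [partialDeriv_eq_fderiv (differentiableAt_pi.1 hd i), fderiv_apply hd]
  exact congrFun (fderiv_flow_time hΩ hv ha) i

theorem pderiv_taylorSeries_flow (hΩ : IsOpen Ω) (hv : ContDiffOn ℝ ∞ v Ω) (i : Fin s)
    {a : Fin (s + 1) → ℝ} (ha : a ∈ flowDomain v Ω t₀) :
    pderiv ℝ 0 (taylorSeries a fun x => flow v Ω t₀ x i)
      = taylorSeries a ((fun y => v y i) ∘ graphFlow v Ω t₀) := by
  have hD := isOpen_flowDomain (t₀ := t₀) hΩ hv
  rw [pderiv_taylorSeries hD (contDiffOn_flow_apply hΩ hv i) ha,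
    taylorSeries_congr hD (partialDeriv_flow hΩ hv i) ha]

theorem hasDerivAt_timeSpace (τ : ℝ) (x : Fin s → ℝ) :
    HasDerivAt (fun τ => timeSpace τ x) (Pi.single 0 1) τ := by
  refine hasDerivAt_pi.2 fun i => ?_
  induction i using Fin.cases with
  | zero => simpa using hasDerivAt_id' τ
  | succ i => simpa using hasDerivAt_const τ (x i)

/-- Time differentiation commutes with taking Taylor coefficients, so the differential equation of
the flow passes to each coefficient. -/
theorem hasDerivAt_taylorCoeff_flow (hΩ : IsOpen Ω) (hv : ContDiffOn ℝ ∞ v Ω) (i : Fin s)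
    (k : Fin (s + 1) → ℕ) {τ : ℝ} {x : Fin s → ℝ} (ha : timeSpace τ x ∈ flowDomain v Ω t₀) :
    HasDerivAt (fun τ => taylorCoeff (fun x => flow v Ω t₀ x i) k (timeSpace τ x))
      (taylorCoeff ((fun y => v y i) ∘ graphFlow v Ω t₀) k (timeSpace τ x)) τ := by
  have hD := isOpen_flowDomain (t₀ := t₀) hΩ hv
  have hf := contDiffOn_flow_apply (t₀ := t₀) hΩ hv i
  have hd := (contDiffOn_taylorCoeff hD hf k).differentiableAt_of_isOpen hD ha
  have e := partialDeriv_taylorCoeff hD hf k 0 ha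
  rw [(partialDeriv_flow hΩ hv i).taylorCoeff (fun j _ => hD.openAlong j) ha,
    partialDeriv_eq_fderiv hd] at e
  rw [← e]
  exact hd.hasFDerivAt.comp_hasDerivAt τ (hasDerivAt_timeSpace τ x)

/-- On the slice at time `t₀` the flow is the projection to space, and `μ 0 = 0` admits only
derivatives tangent to that slice. -/
theorem flowSum_initial_le (hw : ∀ k, 0 < w k) (hρ : 0 ≤ ρ) (hΩ : IsOpen Ω)
    (hv : ContDiffOn ℝ ∞ v Ω) {x : Fin s → ℝ} (ha : timeSpace t₀ x ∈ flowDomain v Ω t₀)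
    {μ : Fin (s + 1) →₀ ℕ} (hμ : μ 0 = 0) :
    flowSum w ρ μ v Ω t₀ (timeSpace t₀ x) ≤ ρ * ∑ i : Fin s, (w ⇑(Finsupp.single i.succ 1))⁻¹ := by
  rw [Finset.mul_sum]
  refine Finset.sum_le_sum fun i _ => ?_
  let A : Set (Fin (s + 1) → ℝ) := {y | y ∈ flowDomain v Ω t₀ ∧ y 0 = t₀}
  have hD := isOpen_flowDomain (t₀ := t₀) hΩ hv
  have hA : ∀ j : Fin (s + 1), j ≠ 0 → OpenAlong A j := by
    intro j hj y hy
    filter_upwards [hD.openAlong j y hy.1] with r hr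
    exact ⟨hr, by simp [hy.2, Pi.single_eq_of_ne (Ne.symm hj)]⟩
  have hEq : EqOn (fun x => flow v Ω t₀ x i) (fun x => x i.succ) A := by
    intro y hy
    have e : y = timeSpace t₀ (Fin.tail y) := by
      conv_lhs => rw [← timeSpace_tail y, hy.2]
    have hmem := hy.1
    rw [e] at hmem
    change flow v Ω t₀ y i = Fin.tail y i
    conv_lhs => rw [e]
    rw [flow_initial hΩ hv hmem]
  have key : coeffSum w ρ (multiindexBox μ)
        (taylorSeries (timeSpace t₀ x) fun x => flow v Ω t₀ x i)
      = coeffSum w ρ (multiindexBox μ) (taylorSeries (timeSpace t₀ x) fun x => x i.succ) := by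
    refine Finset.sum_congr rfl fun κ hκ => ?_
    rw [coeff_taylorSeries, coeff_taylorSeries, hEq.taylorCoeff (k := κ) (fun j hj => hA j ?_)
      (show timeSpace t₀ x ∈ A from ⟨ha, rfl⟩)]
    rintro rfl
    have := (mem_multiindexBox.1 hκ).2 0
    rw [hμ] at this
    exact hj (Nat.le_zero.1 this)
  rw [key, ← div_eq_mul_inv]
  exact coeffSum_apply_le hw hρ _ _ _

/-- The vector of all weighted Taylor coefficients of the flow, whose `ℓ¹` norm is `flowSum`. -/
def weightedCoeffs (w : (Fin (s + 1) → ℕ) → ℝ) (ρ : ℝ) (K : Finset (Fin (s + 1) →₀ ℕ))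
    (F : Fin s → (Fin (s + 1) → ℝ) → ℝ) (a : Fin (s + 1) → ℝ) :
    PiLp 1 fun _ : Fin s × K => ℝ :=
  WithLp.toLp 1 fun x => taylorCoeff (F x.1) x.2.1 a / w x.2.1 * ρ ^ x.2.1.degree

theorem norm_weightedCoeffs (hw : ∀ k, 0 < w k) (hρ : 0 ≤ ρ) (K : Finset (Fin (s + 1) →₀ ℕ))
    (F : Fin s → (Fin (s + 1) → ℝ) → ℝ) (a : Fin (s + 1) → ℝ) :
    ‖weightedCoeffs w ρ K F a‖ = ∑ i, coeffSum w ρ K (taylorSeries a (F i)) := by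
  rw [PiLp.norm_eq_of_L1, Fintype.sum_prod_type]
  refine Finset.sum_congr rfl fun i _ => ?_
  rw [coeffSum, ← Finset.sum_coe_sort K]
  refine Finset.sum_congr rfl fun κ _ => ?_
  rw [weightedCoeffs, Real.norm_eq_abs, abs_mul, abs_div, abs_of_pos (hw _),
    abs_of_nonneg (pow_nonneg hρ _)]
  rfl

/-- The composition estimate is applied with the graph map of the flow inside, in dimension `s + 1`.
-/
theorem sum_coeffSum_field_le (hw : ∀ k, 0 < w k) (hρ : 0 ≤ ρ) (hc : 0 ≤ c) (hF : FdBBound w c)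
    (hΩ : IsOpen Ω) (hv : ContDiffOn ℝ ∞ v Ω) (hC : 0 ≤ C) (hR : 0 ≤ R) {a : Fin (s + 1) → ℝ}
    (ha : a ∈ flowDomain v Ω t₀) (hb : TaylorBound w v C R (graphFlow v Ω t₀ a))
    {μ : Fin (s + 1) →₀ ℕ} {G : ℝ}
    (hG : coeffSum w ρ (multiindexBox μ) (taylorSeries a fun x => x 0)
        + flowSum w ρ μ v Ω t₀ a ≤ G) (hsmall : 2 * c * R * G ≤ 1) :
    ∑ i, coeffSum w ρ (multiindexBox μ) (taylorSeries a ((fun y => v y i) ∘ graphFlow v Ω t₀))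
      ≤ s * (C * 2 ^ (s + 2) * c * R) * G := by
  have : ∀ i : Fin s, coeffSum w ρ (multiindexBox μ)
      (taylorSeries a ((fun y => v y i) ∘ graphFlow v Ω t₀)) ≤ C * 2 ^ (s + 2) * c * R * G :=
    fun i => coeffSum_comp_le hw hρ hc hF (isOpen_flowDomain hΩ hv) hΩ ha
      (contDiffOn_graphFlow hΩ hv) (mapsTo_graphFlow hΩ hv) (contDiffOn_pi.1 hv i) hC hR
      (hb i).2 μ (by rwa [sum_coeffSum_graphFlow]) hsmall
  calc _ ≤ ∑ _i : Fin s, C * 2 ^ (s + 2) * c * R * G := Finset.sum_le_sum fun i _ => this i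
    _ = _ := by
      rw [Finset.sum_const, Finset.card_univ, Fintype.card_fin, nsmul_eq_mul]
      ring

/-- Propagation in time of the bounds for the derivatives of the flow in space. -/
theorem flowSum_space_le (hw : ∀ k, 0 < w k) (hρ : 0 < ρ) (hc : 0 ≤ c) (hF : FdBBound w c)
    (hΩ : IsOpen Ω) (hv : ContDiffOn ℝ ∞ v Ω) (hC : 0 ≤ C) (hR : 0 ≤ R) {p : Fin (s + 1) → ℝ}
    (hp : p ∈ flowDomain v Ω t₀)
    (hb : ∀ τ ∈ uIcc t₀ (p 0), TaylorBound w v C R (graphFlow v Ω t₀ (timeSpace τ (Fin.tail p))))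
    {T L W A : ℝ} (hT : |p 0 - t₀| ≤ T) (hL : L = T * (s * (C * 2 ^ (s + 2) * c * R)) + 1)
    (hW : W = (∑ i : Fin s, (w ⇑(Finsupp.single i.succ 1))⁻¹) + 1) (hA : A = W * Real.exp L)
    (hsmall : 2 * c * R * (ρ * A) ≤ 1) {μ : Fin (s + 1) →₀ ℕ} (hμ : μ 0 = 0) :
    flowSum w ρ μ v Ω t₀ p ≤ ρ * A := by
  set K := multiindexBox μ
  set S := s * (C * 2 ^ (s + 2) * c * R) with hS
  have hS0 : 0 ≤ S := by positivity
  have hT0 : 0 ≤ T := (abs_nonneg _).trans hT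
  have hL1 : 1 ≤ L := by rw [hL]; nlinarith
  have hWpos : 0 < W := by
    have : 0 ≤ ∑ i : Fin s, (w ⇑(Finsupp.single i.succ 1))⁻¹ :=
      Finset.sum_nonneg fun i _ => (inv_pos.2 (hw _)).le
    linarith
  let path : ℝ → Fin (s + 1) → ℝ := fun θ => timeSpace (t₀ + θ * (p 0 - t₀)) (Fin.tail p)
  have hpath : ∀ θ ∈ Icc (0 : ℝ) 1, path θ ∈ flowDomain v Ω t₀ := fun θ hθ =>
    timeSpace_mem_flowDomain hp (mem_uIcc_of_unit hθ)
  let Φ : ℝ → PiLp 1 fun _ : Fin s × K => ℝ := fun θ =>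
    weightedCoeffs w ρ K (fun i x => flow v Ω t₀ x i) (path θ)
  let Φ' : ℝ → PiLp 1 fun _ : Fin s × K => ℝ := fun θ => (p 0 - t₀) •
    weightedCoeffs w ρ K (fun i => (fun y => v y i) ∘ graphFlow v Ω t₀) (path θ)
  have hΦ : ∀ θ ∈ Icc (0 : ℝ) 1, HasDerivAt Φ (Φ' θ) θ := by
    intro θ hθ
    have h1 : HasDerivAt (fun θ => fun x : Fin s × K =>
        taylorCoeff (fun y => flow v Ω t₀ y x.1) x.2.1 (path θ) / w x.2.1 * ρ ^ x.2.1.degree)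
        (fun x => (p 0 - t₀) * (taylorCoeff ((fun y => v y x.1) ∘ graphFlow v Ω t₀) x.2.1 (path θ)
          / w x.2.1 * ρ ^ x.2.1.degree)) θ := by
      refine hasDerivAt_pi.2 fun x => ?_
      have h2 := hasDerivAt_taylorCoeff_flow hΩ hv x.1 x.2.1 (hpath θ hθ)
      have h3 : HasDerivAt (fun θ => t₀ + θ * (p 0 - t₀)) (p 0 - t₀) θ := by
        simpa using ((hasDerivAt_id' θ).mul_const (p 0 - t₀)).const_add t₀
      have h4 := ((h2.scomp θ h3).div_const (w x.2.1)).mul_const (ρ ^ x.2.1.degree)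
      refine h4.congr_deriv ?_
      rw [smul_eq_mul]
      ring
    exact (PiLp.continuousLinearEquiv 1 ℝ fun _ : Fin s × K => ℝ).symm.hasFDerivAt.comp_hasDerivAt
      θ h1
  have hnorm : ∀ θ, ‖Φ θ‖ = flowSum w ρ μ v Ω t₀ (path θ) := fun θ =>
    norm_weightedCoeffs hw hρ.le K _ _
  -- The barrier lies below `ρ * A`, where the composition estimate is valid. The derivative
  -- inequality is needed only where the norm meets the barrier, so smallness of the sum need not be
  -- known beforehand.
  have hfence := image_norm_le_of_norm_deriv_right_lt_deriv_boundary (f := Φ) (f' := Φ') (a := 0)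
    (b := 1) (B := fun θ => ρ * W * Real.exp (L * θ))
    (B' := fun θ => ρ * W * (Real.exp (L * θ) * L))
    (fun θ hθ => (hΦ θ hθ).continuousAt.continuousWithinAt)
    (fun θ hθ => (hΦ θ (Ico_subset_Icc_self hθ)).hasDerivWithinAt) ?_ (fun θ => ?_)
    (fun θ hθ heq => ?_)
  · have := hfence (x := 1) ⟨zero_le_one, le_rfl⟩
    have e : path 1 = p := by simp [path]
    rw [hnorm, e, mul_one] at this
    rwa [hA, ← mul_assoc]
  · have e : path 0 = timeSpace t₀ (Fin.tail p) := by simp [path]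
    have h0 := hpath 0 ⟨le_rfl, zero_le_one⟩
    rw [e] at h0
    rw [hnorm, e, mul_zero, Real.exp_zero, mul_one]
    refine (flowSum_initial_le hw hρ.le hΩ hv h0 hμ).trans ?_
    -- The added `1` in `W` keeps the barrier positive even when `s = 0`.
    rw [hW]
    gcongr
    linarith
  · have h1 : HasDerivAt (fun θ => L * θ) L θ := by simpa using (hasDerivAt_id' θ).const_mul L
    exact (h1.exp).const_mul _
  · have hθ' := Ico_subset_Icc_self hθ
    have hexp : Real.exp (L * θ) ≤ Real.exp L :=
      Real.exp_le_exp.2 (mul_le_of_le_one_right (by linarith) hθ'.2)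
    have hBA : ρ * W * Real.exp (L * θ) ≤ ρ * A := by
      rw [hA, ← mul_assoc]
      gcongr
    have hG : coeffSum w ρ K (taylorSeries (path θ) fun x => x 0)
        + flowSum w ρ μ v Ω t₀ (path θ) ≤ ρ * W * Real.exp (L * θ) := by
      rw [coeffSum_apply_eq_zero _ _ hμ, zero_add, ← hnorm, heq]
    have h5 := sum_coeffSum_field_le hw hρ.le hc hF hΩ hv hC hR (hpath θ hθ')
      (hb _ (mem_uIcc_of_unit hθ')) hG
      ((mul_le_mul_of_nonneg_left hBA (by positivity)).trans hsmall)
    rw [← hS] at h5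
    have hpos : 0 < ρ * W * Real.exp (L * θ) := by positivity
    calc ‖Φ' θ‖ = |p 0 - t₀| * ∑ i, coeffSum w ρ K
          (taylorSeries (path θ) ((fun y => v y i) ∘ graphFlow v Ω t₀)) := by
          rw [norm_smul, Real.norm_eq_abs, norm_weightedCoeffs hw hρ.le]
      _ ≤ T * (S * (ρ * W * Real.exp (L * θ))) := by
          refine mul_le_mul hT h5 (Finset.sum_nonneg fun i _ => ?_) hT0
          exact coeffSum_nonneg hw hρ.le _ _
      -- The added `1` in `L` makes the inequality strict.
      _ < L * (ρ * W * Real.exp (L * θ)) := by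
          rw [← mul_assoc]
          exact mul_lt_mul_of_pos_right (by rw [hL]; linarith) hpos
      _ = ρ * W * (Real.exp (L * θ) * L) := by ring

/-- One more time derivative costs one application of the differential equation. -/
theorem coeffSum_flow_le (hw : ∀ k, 0 < w k) (hρ : 0 ≤ ρ) (hΩ : IsOpen Ω)
    (hv : ContDiffOn ℝ ∞ v Ω) {a : Fin (s + 1) → ℝ} (ha : a ∈ flowDomain v Ω t₀) {H : ℝ}
    (hH : ∀ κ : Fin (s + 1) →₀ ℕ, κ ≠ 0 → w κ ≤ H * w ⇑(κ + Finsupp.single 0 1 : Fin (s + 1) →₀ ℕ))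
    (i : Fin s) (μ : Fin (s + 1) →₀ ℕ) :
    coeffSum w ρ (multiindexBox (μ + Finsupp.single 0 1))
        (taylorSeries a fun x => flow v Ω t₀ x i)
      ≤ coeffSum w ρ (multiindexBox (μ.erase 0)) (taylorSeries a fun x => flow v Ω t₀ x i)
        + ρ * (|v (graphFlow v Ω t₀ a) i| / w ⇑(Finsupp.single (0 : Fin (s + 1)) 1)
          + H * coeffSum w ρ (multiindexBox μ)
            (taylorSeries a ((fun y => v y i) ∘ graphFlow v Ω t₀))) := by
  classical
  set F := taylorSeries a fun x => flow v Ω t₀ x i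
  set E := taylorSeries a ((fun y => v y i) ∘ graphFlow v Ω t₀)
  let e₀ : Fin (s + 1) →₀ ℕ := Finsupp.single 0 1
  let term : (Fin (s + 1) →₀ ℕ) → ℝ := fun κ => |coeff κ F| / w κ * ρ ^ κ.degree
  have hterm : ∀ κ, 0 ≤ term κ := fun κ => by have := hw κ; positivity
  -- The factor `κ 0 + 1` from differentiating in time is at least `1` and can be dropped.
  have hshift : ∀ κ : Fin (s + 1) →₀ ℕ, |coeff (κ + e₀) F| ≤ |coeff κ E| := by
    intro κ
    have h1 := congrArg (coeff κ) (pderiv_taylorSeries_flow hΩ hv i ha)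
    rw [coeff_pderiv] at h1
    change _ ≤ |coeff κ (taylorSeries a ((fun y => v y i) ∘ graphFlow v Ω t₀))|
    rw [← h1, abs_mul]
    refine le_mul_of_one_le_right (abs_nonneg _) ?_
    rw [abs_of_nonneg (by positivity)]
    linarith [(κ 0).cast_nonneg (α := ℝ)]
  have hdeg : ∀ κ : Fin (s + 1) →₀ ℕ, (κ + e₀).degree = κ.degree + 1 := fun κ => by
    simp [e₀]
  -- Exponents without time part lie in the box of `μ.erase 0`. The others are shifts by `e₀` of an
  -- element of the box of `μ` or of `0`; the shift of `0` yields the value of `v`.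
  rw [coeffSum, ← Finset.sum_filter_add_sum_filter_not _ (fun κ => κ 0 = 0)]
  refine add_le_add (Finset.sum_le_sum_of_subset_of_nonneg (fun κ hκ => ?_)
    fun κ _ _ => hterm κ) ?_
  · rw [Finset.mem_filter, mem_multiindexBox] at hκ
    refine mem_multiindexBox.2 ⟨hκ.1.1, fun j => ?_⟩
    by_cases hj : j = 0
    · subst hj; simp [hκ.2]
    · rw [Finsupp.erase_ne hj]
      have := hκ.1.2 j
      simpa [Finsupp.single_eq_of_ne hj] using this
  have hsub : (multiindexBox (μ + e₀)).filter (fun κ => ¬ κ 0 = 0)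
      ⊆ (insert 0 (multiindexBox μ)).image (· + e₀) := by
    intro κ hκ
    rw [Finset.mem_filter, mem_multiindexBox] at hκ
    have h1 : e₀ ≤ κ := Finsupp.single_le_iff.2 (Nat.one_le_iff_ne_zero.2 hκ.2)
    refine Finset.mem_image.2 ⟨κ - e₀, ?_, tsub_add_cancel_of_le h1⟩
    rw [Finset.mem_insert, mem_multiindexBox]
    by_cases h0 : κ - e₀ = 0
    · exact Or.inl h0
    · exact Or.inr ⟨h0, tsub_le_iff_right.2 hκ.1.2⟩
  calc ∑ κ ∈ (multiindexBox (μ + e₀)).filter (fun κ => ¬ κ 0 = 0), term κ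
      ≤ ∑ κ ∈ (insert 0 (multiindexBox μ)).image (· + e₀), term κ :=
        Finset.sum_le_sum_of_subset_of_nonneg hsub fun κ _ _ => hterm κ
    _ = ∑ κ ∈ insert 0 (multiindexBox μ), term (κ + e₀) :=
        Finset.sum_image fun _ _ _ _ h => add_right_cancel h
    _ = term (0 + e₀) + ∑ κ ∈ multiindexBox μ, term (κ + e₀) :=
        Finset.sum_insert (by simp [multiindexBox])
    _ ≤ ρ * (|v (graphFlow v Ω t₀ a) i| / w ⇑e₀)
        + ∑ κ ∈ multiindexBox μ, ρ * (H * (|coeff κ E| / w κ * ρ ^ κ.degree)) := by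
        refine add_le_add ?_ (Finset.sum_le_sum fun κ hκ => ?_)
        · have h1 := hshift 0
          have h2 : coeff 0 E = v (graphFlow v Ω t₀ a) i := by
            rw [coeff_zero_eq_constantCoeff_apply, constantCoeff_taylorSeries]; rfl
          rw [h2] at h1
          have h3 : ρ ^ e₀.degree = ρ := by simp [e₀]
          rw [zero_add] at h1
          simp only [term, zero_add, h3]
          rw [mul_comm]
          have := hw e₀
          gcongr
        · have h1 := hshift κ
          have h2 := hH κ (mem_multiindexBox.1 hκ).1
          have h3 := hw κ
          have h4 := hw ⇑(κ + e₀)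
          have h5 : (w ⇑(κ + e₀))⁻¹ ≤ H * (w κ)⁻¹ := by
            rw [← div_eq_mul_inv, le_div_iff₀ h3, inv_mul_le_iff₀ h4, mul_comm]
            exact h2
          simp only [term, hdeg]
          calc |coeff (κ + e₀) F| / w ⇑(κ + e₀) * ρ ^ (κ.degree + 1)
              = |coeff (κ + e₀) F| * (w ⇑(κ + e₀))⁻¹ * ρ ^ (κ.degree + 1) := by
                rw [div_eq_mul_inv]
            _ ≤ |coeff κ E| * (H * (w κ)⁻¹) * ρ ^ (κ.degree + 1) := by gcongr
            _ = ρ * (H * (|coeff κ E| / w κ * ρ ^ κ.degree)) := by ring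
    _ = _ := by
        rw [coeffSum, mul_add, Finset.mul_sum, Finset.mul_sum]

/-- Bounds for all derivatives of the flow from bounds for its derivatives in space. -/
theorem flowSum_le (hw : ∀ k, 0 < w k) (hρ : 0 ≤ ρ) (hc : 0 ≤ c) (hF : FdBBound w c)
    (hΩ : IsOpen Ω) (hv : ContDiffOn ℝ ∞ v Ω) (hC : 0 ≤ C) (hR : 0 ≤ R) {a : Fin (s + 1) → ℝ}
    (ha : a ∈ flowDomain v Ω t₀) (hb : TaylorBound w v C R (graphFlow v Ω t₀ a)) {H : ℝ}
    (hH0 : 0 ≤ H)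
    (hH : ∀ κ : Fin (s + 1) →₀ ℕ, κ ≠ 0 → w κ ≤ H * w ⇑(κ + Finsupp.single 0 1 : Fin (s + 1) →₀ ℕ))
    {A B : ℝ} (hA : ∀ μ : Fin (s + 1) →₀ ℕ, μ 0 = 0 → flowSum w ρ μ v Ω t₀ a ≤ ρ * A)
    (hB : B = A + s * C * ((w ⇑(Finsupp.single (0 : Fin (s + 1)) 1))⁻¹ + H * 2 ^ (s + 1)))
    (hsmall : 2 * c * R * (ρ * (B + (w ⇑(Finsupp.single (0 : Fin (s + 1)) 1))⁻¹)) ≤ 1)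
    (μ : Fin (s + 1) →₀ ℕ) : flowSum w ρ μ v Ω t₀ a ≤ ρ * B := by
  have hw0 := hw ⇑(Finsupp.single (0 : Fin (s + 1)) 1)
  set b₀ := (w ⇑(Finsupp.single (0 : Fin (s + 1)) 1))⁻¹ with hb₀
  have hb₀' : 0 ≤ b₀ := (inv_pos.2 hw0).le
  have hAB : ρ * A ≤ ρ * B := by
    rw [hB, mul_add]
    exact le_add_of_nonneg_right (by positivity)
  -- The bound by `ρ * B` is carried unchanged through all orders of time derivatives.
  induction hJ : μ 0 generalizing μ with
  | zero => exact (hA μ hJ).trans hAB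
  | succ J ih =>
    have hle : Finsupp.single 0 1 ≤ μ := Finsupp.single_le_iff.2 (by omega)
    obtain ⟨ν, rfl⟩ : ∃ ν, μ = ν + Finsupp.single 0 1 := ⟨_, (tsub_add_cancel_of_le hle).symm⟩
    have hν := ih ν (by simpa using hJ)
    have hG : coeffSum w ρ (multiindexBox ν) (taylorSeries a fun x => x 0)
        + flowSum w ρ ν v Ω t₀ a ≤ ρ * (B + b₀) := by
      have := coeffSum_apply_le hw hρ a 0 ν
      rw [div_eq_mul_inv] at this
      linarith
    have h1 := sum_coeffSum_field_le hw hρ hc hF hΩ hv hC hR ha hb hG hsmall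
    -- Smallness replaces the bound inherited from `ν` by one that does not involve `B`, so the
    -- recursion closes with the same `B`.
    have h2 : ∑ i, coeffSum w ρ (multiindexBox ν)
        (taylorSeries a ((fun y => v y i) ∘ graphFlow v Ω t₀)) ≤ s * C * 2 ^ (s + 1) := by
      refine h1.trans ?_
      calc s * (C * 2 ^ (s + 2) * c * R) * (ρ * (B + b₀))
          = s * C * 2 ^ (s + 1) * (2 * c * R * (ρ * (B + b₀))) := by ring
        _ ≤ s * C * 2 ^ (s + 1) * 1 := by gcongr
        _ = _ := mul_one _
    calc flowSum w ρ (ν + Finsupp.single 0 1) v Ω t₀ a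
        ≤ ∑ i, (coeffSum w ρ (multiindexBox (ν.erase 0))
            (taylorSeries a fun x => flow v Ω t₀ x i)
          + ρ * (C * b₀ + H * coeffSum w ρ (multiindexBox ν)
            (taylorSeries a ((fun y => v y i) ∘ graphFlow v Ω t₀)))) := by
          refine Finset.sum_le_sum fun i _ =>
            (coeffSum_flow_le hw hρ hΩ hv ha hH i ν).trans ?_
          rw [div_eq_mul_inv]
          have := (hb i).1
          gcongr
      _ = flowSum w ρ (ν.erase 0) v Ω t₀ a + ρ * (s * (C * b₀)
          + H * ∑ i, coeffSum w ρ (multiindexBox ν)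
            (taylorSeries a ((fun y => v y i) ∘ graphFlow v Ω t₀))) := by
          rw [Finset.sum_add_distrib, ← Finset.mul_sum, Finset.sum_add_distrib, Finset.sum_const,
            Finset.card_univ, Fintype.card_fin, nsmul_eq_mul, ← Finset.mul_sum, flowSum]
      _ ≤ ρ * A + ρ * (s * (C * b₀) + H * (s * C * 2 ^ (s + 1))) := by
          have := hA (ν.erase 0) (by simp)
          gcongr
      _ = ρ * B := by rw [hB]; ring

end FlowEstimates

/-! ### Uniformity near a point and choice of the radius -/

section MainTheorem

variable {s : ℕ} {w : (Fin (s + 1) → ℕ) → ℝ} {v : (Fin (s + 1) → ℝ) → Fin s → ℝ}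
  {Ω : Set (Fin (s + 1) → ℝ)} {t₀ : ℝ}

/-- The trajectories that end near a point of the flow domain stay in a tube on which the field
satisfies uniform bounds. -/
theorem exists_tube (hw : ∀ k, 0 < w k) (hΩ : IsOpen Ω) (hv : ClassE w v Ω)
    {p₁ : Fin (s + 1) → ℝ} (hp₁ : p₁ ∈ flowDomain v Ω t₀) :
    ∃ C R δ : ℝ, 0 ≤ C ∧ 0 ≤ R ∧ 0 < δ ∧ ∀ p ∈ Metric.ball p₁ δ, ∀ τ ∈ uIcc t₀ (p 0),
      timeSpace τ (Fin.tail p) ∈ flowDomain v Ω t₀ ∧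
      TaylorBound w v C R (graphFlow v Ω t₀ (timeSpace τ (Fin.tail p))) := by
  have hD := isOpen_flowDomain (t₀ := t₀) hΩ hv.1
  have hg := (contDiffOn_graphFlow (t₀ := t₀) hΩ hv.1).continuousOn
  let Γ : Set (Fin (s + 1) → ℝ) := (fun τ => timeSpace τ (Fin.tail p₁)) '' uIcc t₀ (p₁ 0)
  have hpc : Continuous fun τ : ℝ => timeSpace τ (Fin.tail p₁) :=
    continuous_iff_continuousAt.2 fun τ => (hasDerivAt_timeSpace τ _).continuousAt
  have hΓ : IsCompact Γ := isCompact_uIcc.image hpc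
  have hΓD : Γ ⊆ flowDomain v Ω t₀ := by
    rintro _ ⟨τ, hτ, rfl⟩
    exact timeSpace_mem_flowDomain hp₁ hτ
  obtain ⟨C, R, hC, hR, hb⟩ := hv.exists_taylorBound_nhdsSet hw hΩ
    (hΓ.image_of_continuousOn (hg.mono hΓD))
    ((image_mono hΓD).trans (mapsTo_graphFlow hΩ hv.1).image_subset)
  obtain ⟨V, hV, hΓV, hVb⟩ := eventually_nhdsSet_iff_exists.1 hb
  obtain ⟨δ, hδ, hthick⟩ := hΓ.exists_thickening_subset_open (hg.isOpen_inter_preimage hD hV)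
    fun q hq => ⟨hΓD hq, hΓV (mem_image_of_mem _ hq)⟩
  refine ⟨C, R, δ, hC, hR, hδ, fun p hp τ hτ => ?_⟩
  rw [← segment_eq_uIcc, segment_eq_image'] at hτ
  obtain ⟨θ, hθ, rfl⟩ := hτ
  simp only [smul_eq_mul]
  rw [Metric.mem_ball, dist_pi_lt_iff hδ] at hp
  -- Points at the same fraction `θ` of the two time intervals are compared: their times differ by
  -- `θ * (p 0 - p₁ 0)`, so the distance stays below `δ`.
  have hmem : timeSpace (t₀ + θ * (p 0 - t₀)) (Fin.tail p) ∈ Metric.thickening δ Γ := by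
    refine Metric.mem_thickening_iff.2
      ⟨_, ⟨t₀ + θ * (p₁ 0 - t₀), mem_uIcc_of_unit hθ, rfl⟩, (dist_pi_lt_iff hδ).2 fun i => ?_⟩
    induction i using Fin.cases with
    | zero =>
      have h0 := hp 0
      rw [Real.dist_eq] at h0
      change dist (t₀ + θ * (p 0 - t₀)) (t₀ + θ * (p₁ 0 - t₀)) < δ
      rw [Real.dist_eq]
      have e : t₀ + θ * (p 0 - t₀) - (t₀ + θ * (p₁ 0 - t₀)) = θ * (p 0 - p₁ 0) := by ring
      rw [e, abs_mul, abs_of_nonneg hθ.1]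
      exact (mul_le_of_le_one_left (abs_nonneg _) hθ.2).trans_lt h0
    | succ i => exact hp i.succ
  exact ⟨(hthick hmem).1, hVb _ (hthick hmem).2⟩

theorem classE_flow (hw : ∀ k, 0 < w k) (hF : StrictlyFdB w) (hΩ : IsOpen Ω) (hv : ClassE w v Ω) :
    ClassE w (flow v Ω t₀) (flowDomain v Ω t₀) := by
  refine ⟨contDiffOn_flow hΩ hv.1, fun p₁ hp₁ => ?_⟩
  obtain ⟨c, hc1, hFc⟩ := hF
  have hc : 0 ≤ c := zero_le_one.trans hc1
  obtain ⟨H, hH0, hH⟩ := FdBBound.exists_shift_le hw hFc (0 : Fin (s + 1))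
  obtain ⟨C, R, δ, hC, hR, hδ, htube⟩ := exists_tube hw hΩ hv hp₁
  -- `T` bounds the length of the time interval for every point of the ball. None of the constants
  -- up to `M` involves `ρ`.
  let T := |p₁ 0 - t₀| + δ
  let L := T * (s * (C * 2 ^ (s + 2) * c * R)) + 1
  let W := (∑ i : Fin s, (w ⇑(Finsupp.single i.succ 1))⁻¹) + 1
  let A := W * Real.exp L
  let b₀ := (w ⇑(Finsupp.single (0 : Fin (s + 1)) 1))⁻¹
  let B := A + s * C * (b₀ + H * 2 ^ (s + 1))
  have hW : 0 ≤ W := add_nonneg (Finset.sum_nonneg fun i _ => (inv_pos.2 (hw _)).le) zero_le_one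
  have hb₀ : 0 ≤ b₀ := (inv_pos.2 (hw _)).le
  have hA : 0 ≤ A := mul_nonneg hW (Real.exp_pos _).le
  have hAB : A ≤ B := le_add_of_nonneg_right (by positivity)
  have hB : 0 ≤ B := hA.trans hAB
  let M := 2 * c * R * (B + b₀)
  have hM : 0 ≤ M := by positivity
  -- This radius makes the smallness quantity `M / (M + 1)`, also when `M = 0`; the condition for
  -- `A` follows from `A ≤ B`.
  let ρ := (M + 1)⁻¹
  have hρ : 0 < ρ := by positivity
  have hsmall : 2 * c * R * (ρ * (B + b₀)) ≤ 1 := by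
    have : 2 * c * R * (ρ * (B + b₀)) = M / (M + 1) := by
      simp only [M, ρ, div_eq_mul_inv]
      ring
    rw [this]
    exact div_le_one_of_le₀ (by linarith) (by linarith)
  have hsmallA : 2 * c * R * (ρ * A) ≤ 1 := by
    refine le_trans ?_ hsmall
    gcongr
    linarith
  have hsub : ∀ p ∈ Metric.ball p₁ δ, p ∈ flowDomain v Ω t₀ := fun p hp => by
    have := (htube p hp (p 0) right_mem_uIcc).1
    rwa [timeSpace_tail] at this
  refine ⟨Metric.ball p₁ δ, Metric.ball_mem_nhds _ hδ, hsub, ρ, hρ,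
    lt_of_le_of_lt (iSup₂_le fun p hp => ?_) (ENNReal.ofReal_lt_top (r := ρ * B))⟩
  have hT : |p 0 - t₀| ≤ T := by
    have h1 := (dist_le_pi_dist p p₁ 0).trans (Metric.mem_ball.1 hp).le
    rw [Real.dist_eq] at h1
    calc |p 0 - t₀| = |(p 0 - p₁ 0) + (p₁ 0 - t₀)| := by ring_nf
      _ ≤ |p 0 - p₁ 0| + |p₁ 0 - t₀| := abs_add_le _ _
      _ ≤ T := by simp only [T]; linarith
  have hpb : TaylorBound w v C R (graphFlow v Ω t₀ p) := by
    have := (htube p hp (p 0) right_mem_uIcc).2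
    rwa [timeSpace_tail] at this
  have hspace : ∀ μ : Fin (s + 1) →₀ ℕ, μ 0 = 0 → flowSum w ρ μ v Ω t₀ p ≤ ρ * A := fun μ hμ =>
    flowSum_space_le hw hρ hc hFc hΩ hv.1 hC hR (hsub p hp) (fun τ hτ => (htube p hp τ hτ).2)
      hT rfl rfl rfl hsmallA hμ
  have hall := flowSum_le hw hρ.le hc hFc hΩ hv.1 hC hR (hsub p hp) hpb hH0 hH hspace rfl hsmall
  refine iSup_le fun i => scalarSeminorm_le_of_coeffSum_le hw hρ.le fun μ => le_trans ?_ (hall μ)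
  exact Finset.single_le_sum (f := fun i => coeffSum w ρ (multiindexBox μ)
    (taylorSeries p fun x => flow v Ω t₀ x i))
    (fun i _ => coeffSum_nonneg hw hρ.le _ _) (Finset.mem_univ i)

end MainTheorem

end Ultradiff

end

theorem mainTheorem7 {s : ℕ} (m' : ℕ → ℝ) (m : (Fin s → ℕ) → ℝ)
    (hm' : ∀ j, 0 < m' j) (hm : ∀ k, 0 < m k)
    (hFdB : Ultradiff.StrictlyFdB (Ultradiff.productWeight m' m))
    (Ω : Set (Fin (s + 1) → ℝ)) (hΩ : IsOpen Ω)
    (v : (Fin (s + 1) → ℝ) → Fin s → ℝ)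
    (hv : Ultradiff.ClassE (Ultradiff.productWeight m' m) v Ω) (t₀ : ℝ) :
    IsOpen (Ultradiff.flowDomain v Ω t₀) ∧
      Ultradiff.ClassE (Ultradiff.productWeight m' m) (Ultradiff.flow v Ω t₀)
        (Ultradiff.flowDomain v Ω t₀) :=
  ⟨Ultradiff.isOpen_flowDomain hΩ hv.1,
    Ultradiff.classE_flow (fun _ => mul_pos (hm' _) (hm _)) hFdB hΩ hv⟩
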